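/- For coprime integers $2\le p<q$ and $r\ge 0$ put $n=2pq+r$, and for positive integers $a,b,c,d$ with $a+b+c+d=n$ let the difference cycle $(a:b:c:d)$ be the set of all tetrahedra $\{x,\,x+a,\,x+a+b,\,x+a+b+c\}$, $x\in\mathbb Z/n$. Let $1\le m\le q-1$ and $1\le l\le p-1$ be the unique integers with $mp-lq=1$. Let $\operatorname{M}(p,q,r)$ be the simplicial complex on the vertex set $\mathbb Z/n$ whose facets are the tetrahedra of the following difference cycles: * $(1:lq:(q-m)p:pq+r)$, $(1:lq:pq+r:(q-m)p)$ and $(1:pq+r:lq:(q-m)p)$; * $(b:a:b:n-2b-a)$ for all pairs $(a,b)$ obtained after at least one step of the subtractive Euclidean algorithm ($(a,b)\mapsto(a-b,b)$ if $a>b$, $(a,b)\mapsto(b-a,a)$ if $a<b$, stop if $a=b$) started at $((p-l)q,\,lq)$ or at $((q-m)p,\,mp)$; * $(1:pq-1+i:1:pq-1+r-i)$ for $0\le i\le\lfloor r/2\rfloor$. **Theorem.** Let $q>2$ be prime and $k\ge 0$. The automorphism group $G=\operatorname{Aut}(\operatorname{M}(2,q,2kq))$, that is, the group of all vertex permutations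 preserving the complex, is cyclic of order $2q(k+2)$, generated by the rotation $v\mapsto v+1$; write $G\cong\mathbb Z_{2q(k+2)}$, with the rotation corresponding to $1$. The group $H_1(\operatorname{M}(2,q,2kq);\mathbb Z)$ is isomorphic to $\mathbb Z^{q-1}$, and it has a basis with respect to which the induced action of $G$ on it is the homomorphism $$\rho: G\to \operatorname{SL}(q-1,\mathbb Z),\qquad g\mapsto \begin{pmatrix} 0 & \cdots & \cdots & 0 & -1\\ 1 & 0 & \cdots & 0 & 1\\ 0 & \ddots & \ddots & \vdots & \vdots\\ \vdots & \ddots & \ddots & 0 & -1\\ 0 & \cdots & 0 & 1 & 1 \end{pmatrix}^{g}\qquad (g\in\mathbb Z_{2q(k+2)}),$$ where the matrix has ones on the subdiagonal, last column $(-1,1,-1,1,\dots,-1,1)^T$, and zeros elsewhere. Moreover $|\rho(G)|=2q$. -/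

import Mathlib

/-! ### Automorphisms and first homology of an abstract simplicial complex -/

namespace PreAbstractSimplicialComplex

variable {V : Type*} [DecidableEq V]

/-- The automorphism group of a simplicial complex: all permutations of the vertices which map
the complex onto itself. -/
def autGroup (K : PreAbstractSimplicialComplex V) : Subgroup (Equiv.Perm V) where
  carrier := {σ | ∀ s : Finset V, s.map σ.toEmbedding ∈ K.faces ↔ s ∈ K.faces}
  mul_mem' := by
    intro σ τ hσ hτ s
    rw [← hτ s, ← hσ (s.map τ.toEmbedding), Finset.map_map]
    rfl
  one_mem' := by
    intro s
    have h : s.map (1 : Equiv.Perm V).toEmbedding = s := by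
      ext x
      simp [Equiv.Perm.one_def]
    rw [h]
  inv_mem' := by
    intro σ hσ s
    rw [← hσ (s.map (σ⁻¹).toEmbedding), Finset.map_map]
    have h : s.map ((σ⁻¹).toEmbedding.trans σ.toEmbedding) = s := by
      ext x; simp
    rw [h]

/-- Boundary of an ordered edge `(u, v)`, namely `v - u`, extended linearly. -/
noncomputable def boundaryOne (V : Type*) : (V × V →₀ ℤ) →ₗ[ℤ] (V →₀ ℤ) :=
  Finsupp.linearCombination ℤ fun e => Finsupp.single e.2 1 - Finsupp.single e.1 1

/-- Boundary of an ordered triangle `(u, v, w)`, namely `(v, w) - (u, w) + (u, v)`, extended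
linearly. -/
noncomputable def boundaryTwo (V : Type*) : (V × V × V →₀ ℤ) →ₗ[ℤ] (V × V →₀ ℤ) :=
  Finsupp.linearCombination ℤ fun t =>
    Finsupp.single (t.2.1, t.2.2) 1 - Finsupp.single (t.1, t.2.2) 1
      + Finsupp.single (t.1, t.2.1) 1

/-- Ordered simplicial `1`-chains: integer combinations of pairs of vertices spanning a face
(repetitions allowed, as usual for the ordered chain complex). -/
def chainsOne (K : PreAbstractSimplicialComplex V) : Submodule ℤ (V × V →₀ ℤ) :=
  Finsupp.supported ℤ ℤ {e | ({e.1, e.2} : Finset V) ∈ K.faces}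

/-- Ordered simplicial `2`-chains: integer combinations of triples of vertices spanning a face
(repetitions allowed). -/
def chainsTwo (K : PreAbstractSimplicialComplex V) : Submodule ℤ (V × V × V →₀ ℤ) :=
  Finsupp.supported ℤ ℤ {t | ({t.1, t.2.1, t.2.2} : Finset V) ∈ K.faces}

/-- Simplicial `1`-cycles. -/
noncomputable def cyclesOne (K : PreAbstractSimplicialComplex V) : Submodule ℤ (V × V →₀ ℤ) :=
  K.chainsOne ⊓ LinearMap.ker (boundaryOne V)

/-- Simplicial `1`-boundaries. -/
noncomputable def boundariesOne (K : PreAbstractSimplicialComplex V) :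
    Submodule ℤ (V × V →₀ ℤ) :=
  K.chainsTwo.map (boundaryTwo V)

/-- Every `1`-boundary is a `1`-cycle. -/
theorem boundariesOne_le_cyclesOne (K : PreAbstractSimplicialComplex V) :
    K.boundariesOne ≤ K.cyclesOne := by
  rw [boundariesOne, chainsTwo, Finsupp.supported_eq_span_single, Submodule.map_span,
    Submodule.span_le]
  rintro _ ⟨_, ⟨⟨u, v, w⟩, ht, rfl⟩, rfl⟩
  have ht' : ({u, v, w} : Finset V) ∈ K.faces := ht
  have hface : ∀ a b : V, ({a, b} : Finset V) ⊆ {u, v, w} →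
      Finsupp.single (a, b) (1 : ℤ) ∈ K.chainsOne := by
    intro a b hab
    exact Finsupp.single_mem_supported ℤ 1
      ((K.isRelLowerSet_faces ht').2 hab (Finset.insert_nonempty _ _))
  refine ⟨?_, ?_⟩
  · simp only [boundaryTwo, Finsupp.linearCombination_single, one_smul]
    refine add_mem (sub_mem (hface _ _ ?_) (hface _ _ ?_)) (hface _ _ ?_) <;>
      · intro x hx
        simp only [Finset.mem_insert, Finset.mem_singleton] at hx ⊢
        tauto
  · simp only [boundaryTwo, boundaryOne, SetLike.mem_coe, LinearMap.mem_ker,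
      Finsupp.linearCombination_single, one_smul, map_add, map_sub]
    abel

/-- The first simplicial homology group `H₁(K; ℤ)`: cycles modulo boundaries. -/
abbrev HOne (K : PreAbstractSimplicialComplex V) : Type _ :=
  K.cyclesOne ⧸ K.boundariesOne.submoduleOf K.cyclesOne

/-- The map on `1`-chains induced by a map of vertices. -/
noncomputable def chainMap (σ : Equiv.Perm V) : (V × V →₀ ℤ) →ₗ[ℤ] (V × V →₀ ℤ) :=
  Finsupp.lmapDomain ℤ ℤ (Prod.map σ σ)

theorem chainMap_mem_cyclesOne (K : PreAbstractSimplicialComplex V) (σ : K.autGroup) :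
    ∀ c ∈ K.cyclesOne, chainMap (σ : Equiv.Perm V) c ∈ K.cyclesOne := by
  rintro c ⟨h1, h2⟩
  refine ⟨?_, ?_⟩
  · have h := Finsupp.lmapDomain_supported ℤ ℤ (Prod.map (σ : Equiv.Perm V) (σ : Equiv.Perm V))
      {e | ({e.1, e.2} : Finset V) ∈ K.faces}
    have h3 : chainMap (σ : Equiv.Perm V) c ∈ Submodule.map
        (Finsupp.lmapDomain ℤ ℤ (Prod.map (σ : Equiv.Perm V) (σ : Equiv.Perm V)))
        (Finsupp.supported ℤ ℤ {e | ({e.1, e.2} : Finset V) ∈ K.faces}) :=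
      Submodule.mem_map_of_mem h1
    rw [h] at h3
    refine Finsupp.supported_mono ?_ h3
    rintro _ ⟨⟨u, v⟩, huv, rfl⟩
    have h4 := (σ.2 {u, v}).2 huv
    simpa using h4
  · have h : boundaryOne V ∘ₗ chainMap (σ : Equiv.Perm V)
        = Finsupp.lmapDomain ℤ ℤ (σ : Equiv.Perm V) ∘ₗ boundaryOne V := by
      ext e : 2
      simp [boundaryOne, chainMap, Finsupp.mapDomain_sub]
    have h5 := LinearMap.congr_fun h c
    simp only [LinearMap.comp_apply] at h5
    rw [SetLike.mem_coe, LinearMap.mem_ker] at h2 ⊢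
    rw [h5, h2, map_zero]

theorem chainMap_mem_boundariesOne (K : PreAbstractSimplicialComplex V) (σ : K.autGroup) :
    ∀ c ∈ K.boundariesOne, chainMap (σ : Equiv.Perm V) c ∈ K.boundariesOne := by
  rintro _ ⟨c, hc, rfl⟩
  let f : V × V × V → V × V × V :=
    Prod.map (σ : Equiv.Perm V) (Prod.map (σ : Equiv.Perm V) (σ : Equiv.Perm V))
  have h : chainMap (σ : Equiv.Perm V) ∘ₗ boundaryTwo V
      = boundaryTwo V ∘ₗ Finsupp.lmapDomain ℤ ℤ f := by
    ext t : 2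
    simp [boundaryTwo, chainMap, f, Finsupp.mapDomain_sub, Finsupp.mapDomain_add]
  have h5 := LinearMap.congr_fun h c
  simp only [LinearMap.comp_apply] at h5
  rw [h5]
  refine Submodule.mem_map_of_mem ?_
  have h3 : Finsupp.lmapDomain ℤ ℤ f c ∈ Submodule.map (Finsupp.lmapDomain ℤ ℤ f)
      (Finsupp.supported ℤ ℤ {t | ({t.1, t.2.1, t.2.2} : Finset V) ∈ K.faces}) :=
    Submodule.mem_map_of_mem hc
  rw [Finsupp.lmapDomain_supported] at h3
  refine Finsupp.supported_mono ?_ h3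
  rintro _ ⟨⟨u, v, w⟩, huvw, rfl⟩
  have h4 := (σ.2 {u, v, w}).2 huvw
  simpa [f] using h4

/-- The map on `1`-cycles induced by an automorphism. -/
noncomputable def cycleMap (K : PreAbstractSimplicialComplex V) (σ : K.autGroup) :
    K.cyclesOne →ₗ[ℤ] K.cyclesOne :=
  (chainMap (σ : Equiv.Perm V)).restrict (K.chainMap_mem_cyclesOne σ)

/-- The action of the automorphism group on the first homology group: the class of
`∑ cᵢ (uᵢ, vᵢ)` is sent by `σ` to the class of `∑ cᵢ (σ uᵢ, σ vᵢ)`. -/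
noncomputable def homologyAction (K : PreAbstractSimplicialComplex V) :
    Representation ℤ K.autGroup K.HOne where
  toFun σ := Submodule.mapQ _ _ (K.cycleMap σ) fun c hc => K.chainMap_mem_boundariesOne σ c hc
  map_one' := by
    ext c : 2
    have h : K.cycleMap 1 c = c := by
      apply Subtype.ext
      change Finsupp.mapDomain (Prod.map id id) (c : V × V →₀ ℤ) = c
      rw [Prod.map_id, Finsupp.mapDomain_id]
    exact congrArg (Submodule.Quotient.mk (p := K.boundariesOne.submoduleOf K.cyclesOne)) h
  map_mul' σ τ := by
    ext c : 2
    have h : K.cycleMap (σ * τ) c = K.cycleMap σ (K.cycleMap τ c) := by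
      apply Subtype.ext
      change Finsupp.mapDomain _ (c : V × V →₀ ℤ)
        = Finsupp.mapDomain _ (Finsupp.mapDomain _ (c : V × V →₀ ℤ))
      rw [← Finsupp.mapDomain_comp]
      rfl
    exact congrArg (Submodule.Quotient.mk (p := K.boundariesOne.submoduleOf K.cyclesOne)) h

end PreAbstractSimplicialComplex

/-! ### The three-parameter family of cyclic complexes -/

/-- The tetrahedra of the difference cycle `(a : b : c : d)` on `n = a + b + c + d` vertices: the
orbit of `⟨0, a, a + b, a + b + c⟩` under `v ↦ v + 1` on `ℤ/n`. -/
def differenceCycle (n a b c d : ℕ) : Set (Finset (ZMod n)) :=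
  {s | a + b + c + d = n ∧ ∃ x : ZMod n, s = {x, x + a, x + a + b, x + a + b + c}}

/-- One step of the subtractive Euclidean algorithm; there is no step from `(a, a)`. -/
def EuclidStep (s t : ℕ × ℕ) : Prop :=
  (s.2 < s.1 ∧ t = (s.1 - s.2, s.2)) ∨ (s.1 < s.2 ∧ t = (s.2 - s.1, s.1))

/-- The difference cycles `(b : a : b : n - 2 b - a)`, where `(a, b)` runs over all pairs obtained
after at least one step of the Euclidean algorithm with input `x`, `y`. -/
def euclidFacets (n x y : ℕ) : Set (Finset (ZMod n)) :=
  {s | ∃ a b : ℕ, Relation.TransGen EuclidStep (x, y) (a, b) ∧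
    s ∈ differenceCycle n b a b (n - 2 * b - a)}

/-- The tetrahedra of `M(p, q, r)`. Here `m` and `k` are the unique integers with
`1 ≤ m ≤ q - 1`, `1 ≤ k ≤ p - 1` and `m p - k q = 1`. -/
def mFacets (p q r : ℕ) : Set (Finset (ZMod (2 * p * q + r))) :=
  {s | ∃ m k : ℕ, m ∈ Finset.Icc 1 (q - 1) ∧ k ∈ Finset.Icc 1 (p - 1) ∧ m * p = k * q + 1 ∧
    -- the base
    (s ∈ differenceCycle _ 1 (k * q) ((q - m) * p) (p * q + r) ∨
    s ∈ differenceCycle _ 1 (k * q) (p * q + r) ((q - m) * p) ∨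
    s ∈ differenceCycle _ 1 (p * q + r) (k * q) ((q - m) * p) ∨
    -- the three collections of solid tori
    s ∈ euclidFacets _ ((p - k) * q) (k * q) ∨
    s ∈ euclidFacets _ ((q - m) * p) (m * p) ∨
    ∃ i ≤ r / 2, s ∈ differenceCycle _ 1 (p * q - 1 + i) 1 (p * q - 1 + r - i))}

/-- The simplicial complex `M(p, q, r)` on the vertex set `ℤ/(2pq + r)`: all nonempty faces of its
tetrahedra. -/
def mComplex (p q r : ℕ) : PreAbstractSimplicialComplex (ZMod (2 * p * q + r)) where
  faces := {s | s.Nonempty ∧ ∃ t ∈ mFacets p q r, s ⊆ t}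
  isRelLowerSet_faces := by
    rintro s ⟨hs, t, ht, hst⟩
    exact ⟨hs, fun u hu hne => ⟨hne, t, ht, hu.trans hst⟩⟩

/-- The `(q - 1) × (q - 1)` integer matrix with ones on the subdiagonal, last column
`(-1, 1, -1, 1, …)`, and zeros elsewhere. -/
def companionMatrix (q : ℕ) : Matrix (Fin (q - 1)) (Fin (q - 1)) ℤ :=
  Matrix.of fun i j =>
    if (j : ℕ) + 1 = q - 1 then (-1) ^ ((i : ℕ) + 1)
    else if (i : ℕ) = (j : ℕ) + 1 then 1 else 0

/-!
For `q` odd, put `s = k q`, so that `M(2, q, 2 k q)` has `n = 4 q + 2 s` vertices. The Euclidean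
algorithm started at `(q, q)` contributes nothing and, started at `(q - 1, q + 1)`, it runs
through `(2, q - 1), (q - 3, 2), (q - 5, 2), …, (2, 2)`, so that the facets are the translates of
six explicit families of tetrahedra (`FacetType`, `modelledOn_mComplex`), and the triangles those
of nine families (`TriangleType`).

*Automorphisms.* Call the number of triangles at an edge its degree. It depends only on the
difference `d` of the end points, and it is five only for `d = ±q` and possibly `d = ±(q + 1)`.
The edges with `d = ±q` are singled out among these by having further edges of degree five in a
common triangle at both ends (`isRigidEdge_iff`), so an automorphism `σ` permutes them, and
`σ (x + q) = σ x ± q` with a sign which is constant on each line `x, x + q, x + 2 q, …`. Two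
consecutive edges of such a line have the common neighbours `x + q - 1` and `x + 2 q - 1` off the
line; following them from `x` to `x + q` shows `σ (x - 1) = σ x - 1` if the sign is positive, and
`σ (x - 1) = σ x + q - 1` otherwise. The sign is hence the same on all lines. The second case
leads to `q (q - 2) = 0` in `ℤ/n`, which is absurd as `n` is even and `q (q - 2)` is odd. In the
first case `σ` is a rotation (`exists_eq_addRight_of_mem_autGroup`).

*Homology.* Let `F x d` be the loop which runs along the edge from `x` to `x + d` and returns by
steps of length one, and let `a x = F x q`. The triangles show that the loops with
`2 q - 1 ≤ d ≤ n - 2 q + 1` all belong to one class `φ`, that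
`a x = F x (q - 1) = F (x - 1) (q + 1)`, that `F x 2 = a (x + 1) - a (x + 2)`, that `F x (2 j)` is
a sum of loops `F y 2`, and that `a x + a (x + q) = φ`. Comparing the two expressions for
`F x (q - 1)` gives `a x - a (x + 1) + ⋯ + a (x + q - 1) = 0`; adding this to its translate gives
`φ = 0`. The closed path through all vertices in steps of length one is `-2 φ`, so it bounds as
well. Hence the `a x` generate the homology and satisfy the recursion of the companion matrix
(`excess_relations`, `eq_cochain_add_stepPotential`). Conversely the orbit of the first basis
vector under that matrix satisfies the same recursion, and the same formulas define a cocycle with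
values in `ℤ^(q - 1)` (`cochain`, `cochain_cocycle`). Evaluation of this cocycle is the
isomorphism `H₁ ≃ ℤ^(q - 1)`, which turns the rotation into the companion matrix
(`exists_homologyEquiv`).

The companion matrix `C` satisfies `C ^ q = -1`, as its orbits have vanishing alternating sums.
Hence `det C = 1`, and as `C ^ 2 ≠ 1`, for `q` prime `C` has order `2 q`.
-/

/-! ### The facets in normal form -/

/-- The three offsets `a < b < c` of the facets `{x, x + a, x + b, x + c}` of `M(2, q, 2s)`, which
has `4 q + 2 s` vertices. -/
def FacetType (q s a b c : ℕ) : Prop :=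
  (a = 1 ∧ b = q + 1 ∧ c = 2 * q) ∨ (a = q - 1 ∧ b = q ∧ c = 2 * q) ∨
  (a = q ∧ b = 2 * q - 1 ∧ c = 2 * q) ∨ (a = q - 1 ∧ b = q + 1 ∧ c = 2 * q) ∨
  (a = 2 ∧ c = b + 2 ∧ b % 2 = 0 ∧ 4 ≤ b ∧ b + 1 ≤ q) ∨
  (a = 1 ∧ c = b + 1 ∧ 2 * q ≤ b ∧ b ≤ 2 * q + s)

/-- The tetrahedron with base vertex `x` and offsets `a`, `b`, `c`. -/
def quad {n : ℕ} (x : ZMod n) (a b c : ℕ) : Finset (ZMod n) := {x, x + a, x + b, x + c}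

theorem mem_differenceCycle_iff {n a b c d : ℕ} {t : Finset (ZMod n)} :
    t ∈ differenceCycle n a b c d ↔
      a + b + c + d = n ∧ ∃ x, t = quad x a (a + b) (a + b + c) := by
  simp only [differenceCycle, quad, Set.mem_ofPred_eq, Nat.cast_add, add_assoc]

theorem differenceCycle_subset_rotate (n a b c d : ℕ) :
    differenceCycle n a b c d ⊆ differenceCycle n b c d a := by
  rintro t ⟨h, x, rfl⟩
  refine ⟨by omega, x + a, ?_⟩
  have h' : ((a + b + c + d : ℕ) : ZMod n) = 0 := by rw [h, ZMod.natCast_self]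
  push_cast at h'
  have h4 : x + a + b + c + d = x := by linear_combination h'
  rw [h4]
  ext y
  simp only [Finset.mem_insert, Finset.mem_singleton]
  tauto

theorem differenceCycle_rotate (n a b c d : ℕ) :
    differenceCycle n a b c d = differenceCycle n b c d a := by
  apply (differenceCycle_subset_rotate _ _ _ _ _).antisymm
  exact (differenceCycle_subset_rotate _ _ _ _ _).trans
    ((differenceCycle_subset_rotate _ _ _ _ _).trans (differenceCycle_subset_rotate _ _ _ _ _))

/-- The subtractive Euclidean algorithm started at `(q - 1, q + 1)` with `q` odd passes through
`(2, q - 1)` and then through `(a, 2)` for all even `a ≤ q - 3`. -/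
theorem transGen_euclidStep_iff {q : ℕ} (hq : 3 ≤ q) (hodd : q % 2 = 1) (a b : ℕ) :
    Relation.TransGen EuclidStep (q - 1, q + 1) (a, b) ↔
      (a = 2 ∧ b = q - 1) ∨ (b = 2 ∧ a % 2 = 0 ∧ 2 ≤ a ∧ a + 3 ≤ q) := by
  have hstep : Relation.TransGen EuclidStep (q - 1, q + 1) (2, q - 1) :=
    .single (Or.inr ⟨by simp only; omega, Prod.ext (by simp only; omega) rfl⟩)
  constructor
  · suffices H : ∀ y : ℕ × ℕ, Relation.TransGen EuclidStep (q - 1, q + 1) y →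
        (y.1 = 2 ∧ y.2 = q - 1) ∨ (y.2 = 2 ∧ y.1 % 2 = 0 ∧ 2 ≤ y.1 ∧ y.1 + 3 ≤ q) from
      H (a, b)
    intro y hy
    induction hy with
    | single h =>
      rcases h with ⟨h1, rfl⟩ | ⟨h1, rfl⟩ <;> dsimp only at h1 ⊢ <;> omega
    | tail _ h ih =>
      rcases h with ⟨h1, rfl⟩ | ⟨h1, rfl⟩ <;> simp only <;> omega
  · rintro (⟨rfl, rfl⟩ | ⟨rfl, h2, h3, h4⟩)
    · exact hstep
    · obtain ⟨j, hj⟩ : ∃ j, a + 2 * j = q - 3 := ⟨(q - 3 - a) / 2, by omega⟩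
      induction j generalizing a with
      | zero =>
        exact hstep.tail (Or.inr ⟨by simp only; omega, Prod.ext (by simp only; omega) rfl⟩)
      | succ j ih =>
        exact (ih (a + 2) (by omega) (by omega) (by omega) (by omega)).tail
          (Or.inl ⟨by simp only; omega, by ext <;> simp⟩)

theorem not_transGen_euclidStep_self (a : ℕ) (y : ℕ × ℕ) :
    ¬ Relation.TransGen EuclidStep (a, a) y := by
  intro h
  obtain ⟨z, hz, -⟩ := Relation.TransGen.head'_iff.1 h
  rcases hz with ⟨h, -⟩ | ⟨h, -⟩ <;> simp at h

theorem mem_mFacets_iff {q k : ℕ} (hq : 3 ≤ q) (hodd : q % 2 = 1)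
    (t : Finset (ZMod (2 * 2 * q + 2 * k * q))) :
    t ∈ mFacets 2 q (2 * k * q) ↔
      ∃ x a b c, FacetType q (k * q) a b c ∧ t = quad x a b c := by
  have hr : 2 * k * q = 2 * (k * q) := by ring
  constructor
  · rintro ⟨m, l, hm, hl, hml, h⟩
    simp only [Finset.mem_Icc] at hm hl
    obtain rfl : l = 1 := by omega
    have hm2 : (q - m) * 2 = q - 1 := by omega
    have hm3 : m * 2 = q + 1 := by omega
    simp only [hm2, hm3, one_mul] at h
    rcases h with h | h | h | h | h | h
    · obtain ⟨-, x, rfl⟩ := mem_differenceCycle_iff.1 h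
      exact ⟨x, _, _, _, Or.inl ⟨rfl, by omega, by omega⟩, rfl⟩
    · rw [differenceCycle_rotate, differenceCycle_rotate, differenceCycle_rotate] at h
      obtain ⟨-, x, rfl⟩ := mem_differenceCycle_iff.1 h
      exact ⟨x, _, _, _, Or.inr (Or.inl ⟨rfl, by omega, by omega⟩), rfl⟩
    · rw [differenceCycle_rotate, differenceCycle_rotate] at h
      obtain ⟨-, x, rfl⟩ := mem_differenceCycle_iff.1 h
      exact ⟨x, _, _, _, Or.inr (Or.inr (Or.inl ⟨rfl, by omega, by omega⟩)), rfl⟩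
    · obtain ⟨a, b, h, -⟩ := h
      have h2 : (2 - 1) * q = q := by omega
      rw [h2] at h
      exact (not_transGen_euclidStep_self _ _ h).elim
    · obtain ⟨a, b, h, ht⟩ := h
      obtain ⟨-, x, rfl⟩ := mem_differenceCycle_iff.1 ht
      refine ⟨x, _, _, _, ?_, rfl⟩
      rcases (transGen_euclidStep_iff hq hodd a b).1 h with h | h
      · exact Or.inr (Or.inr (Or.inr (Or.inl ⟨by omega, by omega, by omega⟩)))
      · exact Or.inr (Or.inr (Or.inr (Or.inr (Or.inl (by omega)))))
    · obtain ⟨i, hi, h⟩ := h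
      obtain ⟨-, x, rfl⟩ := mem_differenceCycle_iff.1 h
      refine ⟨x, _, _, _, Or.inr (Or.inr (Or.inr (Or.inr (Or.inr ?_)))), rfl⟩
      omega
  · rintro ⟨x, a, b, c, h, rfl⟩
    refine ⟨(q + 1) / 2, 1, Finset.mem_Icc.2 (by omega), Finset.mem_Icc.2 (by omega), by omega, ?_⟩
    have hm2 : (q - (q + 1) / 2) * 2 = q - 1 := by omega
    have hm3 : (q + 1) / 2 * 2 = q + 1 := by omega
    simp only [hm2, hm3, one_mul]
    rcases h with ⟨rfl, rfl, rfl⟩ | ⟨rfl, rfl, rfl⟩ | ⟨rfl, rfl, rfl⟩ | ⟨rfl, rfl, rfl⟩ |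
      ⟨rfl, rfl, h1, h2, h3⟩ | ⟨rfl, rfl, h1, h2⟩
    · left
      refine mem_differenceCycle_iff.2 ⟨by omega, x, ?_⟩
      congr 1 <;> omega
    · right; left
      rw [differenceCycle_rotate, differenceCycle_rotate, differenceCycle_rotate]
      refine mem_differenceCycle_iff.2 ⟨by omega, x, ?_⟩
      congr 1 <;> omega
    · right; right; left
      rw [differenceCycle_rotate, differenceCycle_rotate]
      refine mem_differenceCycle_iff.2 ⟨by omega, x, ?_⟩
      congr 1 <;> omega
    · right; right; right; right; left
      refine ⟨2, q - 1, (transGen_euclidStep_iff hq hodd _ _).2 (by omega), ?_⟩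
      refine mem_differenceCycle_iff.2 ⟨by omega, x, ?_⟩
      congr 1 <;> omega
    · right; right; right; right; left
      refine ⟨b - 2, 2, (transGen_euclidStep_iff hq hodd _ _).2 (by omega), ?_⟩
      refine mem_differenceCycle_iff.2 ⟨by omega, x, ?_⟩
      congr 1 <;> omega
    · right; right; right; right; right
      refine ⟨b - 2 * q, by omega, ?_⟩
      refine mem_differenceCycle_iff.2 ⟨by omega, x, ?_⟩
      congr 1 <;> omega

/-- A complex on `ℤ/n` is *modelled on* `q` and `s` if its facets are the translates of the
tetrahedra of `FacetType q s`. -/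
def ModelledOn {n : ℕ} (K : PreAbstractSimplicialComplex (ZMod n)) (q s : ℕ) : Prop :=
  ∀ t, t ∈ K.faces ↔ t.Nonempty ∧ ∃ x a b c, FacetType q s a b c ∧ t ⊆ quad x a b c

theorem modelledOn_mComplex {q : ℕ} (k : ℕ) (hq : 3 ≤ q) (hodd : q % 2 = 1) :
    ModelledOn (mComplex 2 q (2 * k * q)) q (k * q) := by
  intro t
  change (t.Nonempty ∧ ∃ u ∈ mFacets 2 q (2 * k * q), t ⊆ u) ↔ _
  simp only [mem_mFacets_iff hq hodd]
  constructor
  · rintro ⟨h0, _, ⟨x, a, b, c, h, rfl⟩, ht⟩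
    exact ⟨h0, x, a, b, c, h, ht⟩
  · rintro ⟨h0, x, a, b, c, h, ht⟩
    exact ⟨h0, _, ⟨x, a, b, c, h, rfl⟩, ht⟩

/-! ### The triangles -/

/-- The triangles of a modelled complex are the translates of `{0, A, A + B}` with
`TriangleType q s A B`. -/
def TriangleType (q s A B : ℕ) : Prop :=
  (A = q + 1 ∧ B = q - 1) ∨ (A = q - 1 ∧ B = q + 1) ∨ (A = 1 ∧ B = q) ∨ (A = q - 1 ∧ B = 1) ∨
  (A = q ∧ B = q - 1) ∨ (A = q ∧ B = q) ∨ (A = 2 ∧ B % 2 = 0 ∧ 2 ≤ B ∧ B + 1 ≤ q) ∨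
  (B = 2 ∧ A % 2 = 0 ∧ 2 ≤ A ∧ A + 1 ≤ q) ∨ (A = 1 ∧ 2 * q - 1 ≤ B ∧ B ≤ 2 * q + 2 * s)

/-- The offsets `a < b` of the triangles `{0, a, b}` of a modelled complex on `ℤ/n`: one of the
three cyclic rotations of `(a : b - a : n - b)` is of the type `TriangleType`. -/
def CyclicTriangleType (n q s a b : ℕ) : Prop :=
  TriangleType q s a (b - a) ∨ TriangleType q s (b - a) (n - b) ∨ TriangleType q s (n - b) a

theorem CyclicTriangleType.rotate {n q s a b : ℕ} (hab : a < b) (hb : b < n)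
    (h : CyclicTriangleType n q s a b) : CyclicTriangleType n q s (b - a) (n - a) := by
  have h1 : n - a - (b - a) = n - b := by omega
  have h2 : n - (n - a) = a := by omega
  unfold CyclicTriangleType at h ⊢
  rw [h1, h2]
  tauto

/-- A triple of distinct elements of a four-element set omits one of the four. -/
theorem triple_eq_of_subset {α : Type*} [DecidableEq α] {u v w a b c d : α} (huv : u ≠ v)
    (huw : u ≠ w) (hvw : v ≠ w) (h : ({u, v, w} : Finset α) ⊆ {a, b, c, d}) :
    ({u, v, w} : Finset α) = {a, b, c} ∨ ({u, v, w} : Finset α) = {a, b, d} ∨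
      ({u, v, w} : Finset α) = {a, c, d} ∨ ({u, v, w} : Finset α) = {b, c, d} := by
  have hc : ({u, v, w} : Finset α).card = 3 := Finset.card_eq_three.2 ⟨u, v, w, huv, huw, hvw, rfl⟩
  have key : ∀ t : Finset α, t.card ≤ 3 → ({u, v, w} : Finset α) ⊆ t → {u, v, w} = t :=
    fun t ht h => Finset.eq_of_subset_of_card_le h (by omega)
  have sub : ∀ {x y z t : α}, (x ∉ ({u, v, w} : Finset α) ∨ x ∈ ({y, z, t} : Finset α)) →
      (({u, v, w} : Finset α) ⊆ {x, y, z, t}) → ({u, v, w} : Finset α) = {y, z, t} := by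
    intro x y z t hx h
    refine key _ Finset.card_le_three fun r hr => ?_
    rcases Finset.mem_insert.1 (h hr) with rfl | h'
    · exact hx.resolve_left (fun h => h hr)
    · exact h'
  have hb : ({a, b, c, d} : Finset α) = {b, a, c, d} := by ext; simp; tauto
  have hc' : ({a, b, c, d} : Finset α) = {c, a, b, d} := by ext; simp; tauto
  by_cases h1 : a ∉ ({u, v, w} : Finset α) ∨ a ∈ ({b, c, d} : Finset α)
  · exact Or.inr (Or.inr (Or.inr (sub h1 h)))
  by_cases h2 : b ∉ ({u, v, w} : Finset α) ∨ b ∈ ({a, c, d} : Finset α)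
  · exact Or.inr (Or.inr (Or.inl (sub h2 (hb ▸ h))))
  by_cases h3 : c ∉ ({u, v, w} : Finset α) ∨ c ∈ ({a, b, d} : Finset α)
  · exact Or.inr (Or.inl (sub h3 (hc' ▸ h)))
  left
  push Not at h1 h2 h3
  simp only [Finset.mem_insert, Finset.mem_singleton, not_or] at h1 h2 h3
  refine (Finset.eq_of_subset_of_card_le ?_ ?_).symm
  · simp only [Finset.insert_subset_iff, Finset.singleton_subset_iff, Finset.mem_insert,
      Finset.mem_singleton]
    exact ⟨h1.1, h2.1, h3.1⟩
  · rw [hc, Finset.card_eq_three.2 ⟨a, b, c, h1.2.1, h1.2.2.1, h2.2.2.1, rfl⟩]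

section

variable {n q s : ℕ} {K : PreAbstractSimplicialComplex (ZMod n)}

theorem natCast_eq_of_eq_add_self {n a b : ℕ} (h : a = b + n) : (a : ZMod n) = b := by
  rw [h, Nat.cast_add, ZMod.natCast_self, add_zero]

theorem quad_mem_faces (hK : ModelledOn K q s) {x : ZMod n} {a b c : ℕ}
    (h : FacetType q s a b c) {u v w : ZMod n} (hu : u ∈ quad x a b c) (hv : v ∈ quad x a b c)
    (hw : w ∈ quad x a b c) : ({u, v, w} : Finset (ZMod n)) ∈ K.faces :=
  (hK _).2 ⟨by simp, x, a, b, c, h, by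
    simp only [Finset.insert_subset_iff, Finset.singleton_subset_iff]
    exact ⟨hu, hv, hw⟩⟩

theorem TriangleType.mem_faces (hn : n = 4 * q + 2 * s) (hq : 3 ≤ q) (hodd : q % 2 = 1)
    (hK : ModelledOn K q s) {A B : ℕ} (h : TriangleType q s A B) (x : ZMod n) :
    ({x, x + A, x + A + B} : Finset (ZMod n)) ∈ K.faces := by
  have mem0 : ∀ (y : ZMod n) (a b c : ℕ), y ∈ quad y a b c := by simp [quad]
  have mem1 : ∀ (y : ZMod n) (a b c d : ℕ), d = a → y + (d : ℕ) ∈ quad y a b c := by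
    rintro y a b c d rfl; simp [quad]
  have mem2 : ∀ (y : ZMod n) (a b c d : ℕ), d = b → y + (d : ℕ) ∈ quad y a b c := by
    rintro y a b c d rfl; simp [quad]
  have mem3 : ∀ (y : ZMod n) (a b c d : ℕ), d = c → y + (d : ℕ) ∈ quad y a b c := by
    rintro y a b c d rfl; simp [quad]
  have hx : ∀ d : ℕ, x = x - d + (d : ℕ) := fun d => by ring
  rw [add_assoc, ← Nat.cast_add]
  rcases h with h | h | h | h | h | h | h | h | h
  · exact quad_mem_faces hK (x := x) (a := 1) (b := q + 1) (c := 2 * q) (Or.inl ⟨rfl, rfl, rfl⟩)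
      (mem0 _ _ _ _) (mem2 _ _ _ _ _ (by omega)) (mem3 _ _ _ _ _ (by omega))
  · exact quad_mem_faces hK (x := x) (a := q - 1) (b := q) (c := 2 * q)
      (Or.inr (Or.inl ⟨rfl, rfl, rfl⟩))
      (mem0 _ _ _ _) (mem1 _ _ _ _ _ (by omega)) (mem3 _ _ _ _ _ (by omega))
  · exact quad_mem_faces hK (x := x) (a := 1) (b := q + 1) (c := 2 * q) (Or.inl ⟨rfl, rfl, rfl⟩)
      (mem0 _ _ _ _) (mem1 _ _ _ _ _ (by omega)) (mem2 _ _ _ _ _ (by omega))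
  · exact quad_mem_faces hK (x := x) (a := q - 1) (b := q) (c := 2 * q)
      (Or.inr (Or.inl ⟨rfl, rfl, rfl⟩))
      (mem0 _ _ _ _) (mem1 _ _ _ _ _ (by omega)) (mem2 _ _ _ _ _ (by omega))
  · exact quad_mem_faces hK (x := x) (a := q) (b := 2 * q - 1) (c := 2 * q)
      (Or.inr (Or.inr (Or.inl ⟨rfl, rfl, rfl⟩)))
      (mem0 _ _ _ _) (mem1 _ _ _ _ _ (by omega)) (mem2 _ _ _ _ _ (by omega))
  · exact quad_mem_faces hK (x := x) (a := q) (b := 2 * q - 1) (c := 2 * q)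
      (Or.inr (Or.inr (Or.inl ⟨rfl, rfl, rfl⟩)))
      (mem0 _ _ _ _) (mem1 _ _ _ _ _ (by omega)) (mem3 _ _ _ _ _ (by omega))
  · by_cases hB : B = q - 1
    · rw [hx (q - 1), add_assoc, ← Nat.cast_add, add_assoc, ← Nat.cast_add]
      exact quad_mem_faces hK (a := q - 1) (b := q + 1) (c := 2 * q)
        (Or.inr (Or.inr (Or.inr (Or.inl ⟨rfl, rfl, rfl⟩))))
        (mem1 _ _ _ _ _ (by omega)) (mem2 _ _ _ _ _ (by omega)) (mem3 _ _ _ _ _ (by omega))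
    · exact quad_mem_faces hK (x := x) (a := 2) (b := B + 2) (c := B + 4)
        (Or.inr (Or.inr (Or.inr (Or.inr (Or.inl (by omega))))))
        (mem0 _ _ _ _) (mem1 _ _ _ _ _ (by omega)) (mem2 _ _ _ _ _ (by omega))
  · by_cases hA : A = q - 1
    · exact quad_mem_faces hK (a := q - 1) (b := q + 1) (c := 2 * q)
        (Or.inr (Or.inr (Or.inr (Or.inl ⟨rfl, rfl, rfl⟩))))
        (mem0 _ _ _ _) (mem1 _ _ _ _ _ (by omega)) (mem2 _ _ _ _ _ (by omega))
    · rw [hx 2, add_assoc, ← Nat.cast_add, add_assoc, ← Nat.cast_add]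
      exact quad_mem_faces hK (a := 2) (b := A + 2) (c := A + 4)
        (Or.inr (Or.inr (Or.inr (Or.inr (Or.inl (by omega))))))
        (mem1 _ _ _ _ _ (by omega)) (mem2 _ _ _ _ _ (by omega)) (mem3 _ _ _ _ _ (by omega))
  · by_cases hB : B + 1 ≤ 2 * q + s
    · exact quad_mem_faces hK (x := x) (a := 1) (b := B + 1) (c := B + 2)
        (Or.inr (Or.inr (Or.inr (Or.inr (Or.inr (by omega))))))
        (mem0 _ _ _ _) (mem1 _ _ _ _ _ (by omega)) (mem2 _ _ _ _ _ (by omega))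
    · -- the first two vertices are the last two of the facet based at `x - (n - B)`
      obtain ⟨y, rfl⟩ : ∃ y, x = y + (n - B : ℕ) := ⟨x - (n - B : ℕ), by ring⟩
      refine quad_mem_faces hK (x := y) (a := 1) (b := n - B) (c := n - B + 1)
        (Or.inr (Or.inr (Or.inr (Or.inr (Or.inr (by omega)))))) (mem2 _ _ _ _ _ rfl) ?_ ?_
      · rw [add_assoc, ← Nat.cast_add]
        exact mem3 _ _ _ _ _ (by omega)
      · rw [add_assoc, ← Nat.cast_add, natCast_eq_of_eq_add_self (b := 1) (by omega)]
        exact mem1 _ _ _ _ _ rfl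

theorem CyclicTriangleType.mem_faces (hn : n = 4 * q + 2 * s) (hq : 3 ≤ q) (hodd : q % 2 = 1)
    (hK : ModelledOn K q s) {a b : ℕ} (hab : a < b) (hb : b < n)
    (h : CyclicTriangleType n q s a b) (x : ZMod n) :
    ({x, x + a, x + b} : Finset (ZMod n)) ∈ K.faces := by
  have hab' : x + a + (b - a : ℕ) = x + b := by
    rw [add_assoc, ← Nat.cast_add]; congr 2; omega
  have hbn : x + b + (n - b : ℕ) = x := by
    rw [add_assoc, ← Nat.cast_add, natCast_eq_of_eq_add_self (b := 0) (by omega)]; simp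
  rcases h with h | h | h
  · have := h.mem_faces hn hq hodd hK x
    rwa [hab'] at this
  · have := h.mem_faces hn hq hodd hK (x + a)
    rw [hab', hbn] at this
    convert this using 1
    ext; simp; tauto
  · have := h.mem_faces hn hq hodd hK (x + b)
    rw [hbn] at this
    convert this using 1
    ext; simp; tauto

/-- The triangles in a single facet. -/
theorem FacetType.cyclicTriangleType (hn : n = 4 * q + 2 * s) (hq : 3 ≤ q) (hodd : q % 2 = 1)
    {a b c : ℕ} (h : FacetType q s a b c) :
    (0 < a ∧ a < b ∧ b < c ∧ c < n) ∧ CyclicTriangleType n q s a b ∧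
      CyclicTriangleType n q s a c ∧ CyclicTriangleType n q s b c ∧
      CyclicTriangleType n q s (b - a) (c - a) := by
  rcases h with ⟨rfl, rfl, rfl⟩ | ⟨rfl, rfl, rfl⟩ | ⟨rfl, rfl, rfl⟩ | ⟨rfl, rfl, rfl⟩ |
    ⟨rfl, rfl, h⟩ | ⟨rfl, rfl, h⟩ <;>
  refine ⟨by omega, ?_, ?_, ?_, ?_⟩ <;>
  first
  | exact Or.inl (by unfold TriangleType; omega)
  | exact Or.inr (Or.inl (by unfold TriangleType; omega))

/-- The triangles containing the vertex `0`. -/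
theorem exists_cyclicTriangleType_of_mem_faces (hn : n = 4 * q + 2 * s) (hq : 3 ≤ q)
    (hodd : q % 2 = 1) (hK : ModelledOn K q s) {u v : ZMod n} (hu : 0 ≠ u) (hv : 0 ≠ v)
    (huv : u ≠ v) (h : ({0, u, v} : Finset (ZMod n)) ∈ K.faces) :
    ∃ a b : ℕ, 0 < a ∧ a < b ∧ b < n ∧ CyclicTriangleType n q s a b ∧
      ((u = a ∧ v = b) ∨ (u = b ∧ v = a)) := by
  have H : ∃ (x : ZMod n) (a b : ℕ), 0 < a ∧ a < b ∧ b < n ∧ CyclicTriangleType n q s a b ∧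
      ({0, u, v} : Finset (ZMod n)) = {x, x + a, x + b} := by
    obtain ⟨-, x, a, b, c, hF, hsub⟩ := (hK _).1 h
    obtain ⟨⟨h0, h1, h2, h3⟩, hab, hac, hbc, hd⟩ := hF.cyclicTriangleType hn hq hodd
    rcases triple_eq_of_subset hu hv huv hsub with h | h | h | h
    · exact ⟨x, a, b, h0, h1, by omega, hab, h⟩
    · exact ⟨x, a, c, h0, by omega, by omega, hac, h⟩
    · exact ⟨x, b, c, by omega, by omega, by omega, hbc, h⟩
    · refine ⟨x + a, b - a, c - a, by omega, by omega, by omega, hd, ?_⟩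
      rw [h, add_assoc, add_assoc, ← Nat.cast_add, ← Nat.cast_add]
      congr <;> omega
  obtain ⟨x, a, b, h0, hab, hb, hT, h⟩ := H
  have pair : ∀ {y z : ZMod n}, ({0, u, v} : Finset (ZMod n)) = {0, y, z} →
      (u = y ∧ v = z) ∨ (u = z ∧ v = y) := by
    intro y z hyz
    have h1 : u ∈ ({0, y, z} : Finset (ZMod n)) := hyz ▸ by simp
    have h2 : v ∈ ({0, y, z} : Finset (ZMod n)) := hyz ▸ by simp
    simp only [Finset.mem_insert, Finset.mem_singleton, hu.symm, hv.symm, false_or] at h1 h2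
    rcases h1 with rfl | rfl <;> rcases h2 with rfl | rfl <;> simp_all
  have hx : (0 : ZMod n) ∈ ({x, x + a, x + b} : Finset (ZMod n)) := h ▸ by simp
  simp only [Finset.mem_insert, Finset.mem_singleton] at hx
  have hsub : ∀ {c d : ℕ}, c ≤ d → ((d - c : ℕ) : ZMod n) = d - c := fun h => Nat.cast_sub h
  have hself := ZMod.natCast_self n
  rcases hx with hx | hx | hx
  · subst hx
    simp only [zero_add] at h
    exact ⟨a, b, h0, hab, hb, hT, pair h⟩
  · refine ⟨b - a, n - a, by omega, by omega, by omega, hT.rotate hab hb, pair ?_⟩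
    rw [h, hsub hab.le, hsub (by omega), hself, eq_neg_of_add_eq_zero_left hx.symm]
    ext; simp [add_comm, sub_eq_add_neg]; tauto
  · have hT' := (hT.rotate hab hb).rotate (by omega) (by omega)
    have e1 : n - a - (b - a) = n - b := by omega
    rw [e1] at hT'
    refine ⟨n - b, n - (b - a), by omega, by omega, by omega, hT', pair ?_⟩
    rw [h, hsub hb.le, hsub (by omega), hsub hab.le, hself, eq_neg_of_add_eq_zero_left hx.symm]
    ext; simp [add_comm, sub_eq_add_neg]; tauto

/-- The vertices `w < n` that span a triangle with `0` and `d`, as natural numbers. -/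
def LinkOffset (n q s d w : ℕ) : Prop :=
  (0 < d ∧ d < w ∧ w < n ∧ CyclicTriangleType n q s d w) ∨
    (0 < w ∧ w < d ∧ d < n ∧ CyclicTriangleType n q s w d)

/-- The vertices of the link of the edge `{u, v}`. -/
def edgeLink (K : PreAbstractSimplicialComplex (ZMod n)) (u v : ZMod n) : Set (ZMod n) :=
  {w | w ≠ u ∧ w ≠ v ∧ ({u, v, w} : Finset (ZMod n)) ∈ K.faces}

theorem natCast_injOn {n a b : ℕ} (ha : a < n) (hb : b < n) (h : (a : ZMod n) = b) : a = b := by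
  have := (ZMod.natCast_eq_natCast_iff' a b n).1 h
  rwa [Nat.mod_eq_of_lt ha, Nat.mod_eq_of_lt hb] at this

theorem natCast_mem_edgeLink_iff (hn : n = 4 * q + 2 * s) (hq : 3 ≤ q)
    (hodd : q % 2 = 1) (hK : ModelledOn K q s) {d w : ℕ} (hd0 : 0 < d) (hd : d < n)
    (hw : w < n) : (w : ZMod n) ∈ edgeLink K 0 d ↔ LinkOffset n q s d w := by
  have hne : ∀ {a : ℕ}, 0 < a → a < n → (0 : ZMod n) ≠ a := fun h0 h1 h => by
    have := natCast_injOn (by omega) h1 (Nat.cast_zero.trans h)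
    omega
  constructor
  · rintro ⟨h1, h2, h3⟩
    have hw0 : 0 < w := by
      rcases Nat.eq_zero_or_pos w with rfl | h
      · simp at h1
      · exact h
    obtain ⟨a, b, ha, hab, hb, hT, h | h⟩ := exists_cyclicTriangleType_of_mem_faces hn hq hodd hK
      (hne hd0 hd) (hne hw0 hw) h2.symm h3
    · obtain rfl := natCast_injOn hd (by omega) h.1
      obtain rfl := natCast_injOn hw (by omega) h.2
      exact Or.inl ⟨ha, hab, hb, hT⟩
    · obtain rfl := natCast_injOn hd (by omega) h.1
      obtain rfl := natCast_injOn hw (by omega) h.2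
      exact Or.inr ⟨ha, hab, hb, hT⟩
  · rintro (⟨h0, h1, h2, h3⟩ | ⟨h0, h1, h2, h3⟩)
    · refine ⟨(hne (by omega) (by omega)).symm,
        fun h => by have := natCast_injOn hw hd h; omega, ?_⟩
      simpa using h3.mem_faces hn hq hodd hK h1 h2 0
    · refine ⟨(hne (by omega) (by omega)).symm,
        fun h => by have := natCast_injOn hw hd h; omega, ?_⟩
      have := h3.mem_faces hn hq hodd hK h1 h2 0
      rw [zero_add, zero_add] at this
      convert this using 1
      ext; simp; tauto

end

/-! ### Edge degrees -/

section

variable {n q s : ℕ} {K : PreAbstractSimplicialComplex (ZMod n)}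

/-- The number of triangles containing the edge `{u, v}`. -/
noncomputable def edgeDegree (K : PreAbstractSimplicialComplex (ZMod n)) (u v : ZMod n) : ℕ :=
  (edgeLink K u v).ncard

theorem edgeDegree_le [NeZero n] (hn : n = 4 * q + 2 * s) (hq : 3 ≤ q)
    (hodd : q % 2 = 1) (hK : ModelledOn K q s) {d : ℕ} (hd0 : 0 < d) (hd : d < n) (T : Finset ℕ)
    (hT : ∀ w, LinkOffset n q s d w → w ∈ T) : edgeDegree K 0 d ≤ T.card := by
  classical
  have h : edgeLink K 0 d ⊆ ((T.image (fun w : ℕ => (w : ZMod n)) : Finset (ZMod n)) :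
      Set (ZMod n)) := by
    intro w hw
    rw [← ZMod.natCast_zmod_val w] at hw ⊢
    rw [natCast_mem_edgeLink_iff hn hq hodd hK hd0 hd (ZMod.val_lt w)] at hw
    exact Finset.mem_coe.2 (Finset.mem_image_of_mem _ (hT _ hw))
  calc edgeDegree K 0 d ≤ _ := Set.ncard_le_ncard h (Finset.finite_toSet _)
    _ ≤ T.card := by rw [Set.ncard_coe_finset]; exact Finset.card_image_le

theorem le_edgeDegree [NeZero n] (hn : n = 4 * q + 2 * s) (hq : 3 ≤ q)
    (hodd : q % 2 = 1) (hK : ModelledOn K q s) {d : ℕ} (hd0 : 0 < d) (hd : d < n) (T : Finset ℕ)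
    (hT : ∀ w ∈ T, LinkOffset n q s d w) : T.card ≤ edgeDegree K 0 d := by
  classical
  have hlt : ∀ w ∈ T, w < n := fun w hw => by rcases hT w hw with h | h <;> omega
  have h : ((T.image (fun w : ℕ => (w : ZMod n)) : Finset (ZMod n)) : Set (ZMod n)) ⊆
      edgeLink K 0 d := by
    intro w hw
    obtain ⟨v, hv, rfl⟩ := Finset.mem_image.1 (Finset.mem_coe.1 hw)
    exact (natCast_mem_edgeLink_iff hn hq hodd hK hd0 hd (hlt v hv)).2 (hT v hv)
  calc T.card = (T.image (fun w : ℕ => (w : ZMod n))).card :=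
        (Finset.card_image_of_injOn fun a ha b hb hab =>
          natCast_injOn (hlt a (Finset.mem_coe.1 ha)) (hlt b (Finset.mem_coe.1 hb)) hab).symm
    _ ≤ edgeDegree K 0 d := by
        rw [← Set.ncard_coe_finset]
        exact Set.ncard_le_ncard h (Set.toFinite _)

theorem six_le_edgeDegree [NeZero n] (hn : n = 4 * q + 2 * s) (hq : 3 ≤ q)
    (hodd : q % 2 = 1) (hK : ModelledOn K q s) {d : ℕ} (hd0 : 0 < d) (hd : d < n)
    (a₁ a₂ a₃ a₄ a₅ a₆ : ℕ) (hlt : a₁ < a₂ ∧ a₂ < a₃ ∧ a₃ < a₄ ∧ a₄ < a₅ ∧ a₅ < a₆)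
    (h₁ : LinkOffset n q s d a₁) (h₂ : LinkOffset n q s d a₂) (h₃ : LinkOffset n q s d a₃)
    (h₄ : LinkOffset n q s d a₄) (h₅ : LinkOffset n q s d a₅) (h₆ : LinkOffset n q s d a₆) :
    6 ≤ edgeDegree K 0 d := by
  have hc : ({a₁, a₂, a₃, a₄, a₅, a₆} : Finset ℕ).card = 6 := by
    repeat rw [Finset.card_insert_of_notMem (by
      simp only [Finset.mem_insert, Finset.mem_singleton]; omega)]
    rw [Finset.card_singleton]
  rw [← hc]
  refine le_edgeDegree hn hq hodd hK hd0 hd _ ?_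
  simp only [Finset.mem_insert, Finset.mem_singleton]
  rintro w (rfl | rfl | rfl | rfl | rfl | rfl) <;> assumption

theorem LinkOffset.eq_of_one (hn : n = 4 * q + 2 * s) (hq : 3 ≤ q) (hodd : q % 2 = 1) (hs : s = 0)
    {w : ℕ} (h : LinkOffset n q s 1 w) :
    w = q + 1 ∨ w = 2 * q ∨ w = 2 * q + 1 ∨ w = n + 1 - q := by
  rcases h with ⟨h0, h1, h2, h | h | h⟩ | ⟨h0, h1, h2, h | h | h⟩ <;>
  rcases h with h | h | h | h | h | h | h | h | h <;> omega

theorem LinkOffset.eq_of_small (hn : n = 4 * q + 2 * s) (hodd : q % 2 = 1)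
    {d w : ℕ} (hd : 3 ≤ d) (hd' : d + 2 ≤ 2 * q) (h1 : d ≠ q - 1) (h2 : d ≠ q) (h3 : d ≠ q + 1)
    (h : LinkOffset n q s d w) : w = n - 2 ∨ w = 2 ∨ w = d + 2 ∨ w = d - 2 := by
  rcases h with ⟨h0, h1, h2, h | h | h⟩ | ⟨h0, h1, h2, h | h | h⟩ <;>
  rcases h with h | h | h | h | h | h | h | h | h <;> omega

theorem LinkOffset.eq_of_large (hn : n = 4 * q + 2 * s) (hq : 3 ≤ q)
    {d w : ℕ} (hd : 2 * q < d) (hd' : d ≤ 2 * q + s)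
    (h : LinkOffset n q s d w) : w = 1 ∨ w = n - 1 ∨ w = d - 1 ∨ w = d + 1 := by
  rcases h with ⟨h0, h1, h2, h | h | h⟩ | ⟨h0, h1, h2, h | h | h⟩ <;>
  rcases h with h | h | h | h | h | h | h | h | h <;> omega

theorem LinkOffset.eq_of_two_mul_sub_one (hn : n = 4 * q + 2 * s) (hq : 3 ≤ q) (hodd : q % 2 = 1)
    {w : ℕ} (h : LinkOffset n q s (2 * q - 1) w) : w = n - 1 ∨ w = q ∨ w = 2 * q := by
  rcases h with ⟨h0, h1, h2, h | h | h⟩ | ⟨h0, h1, h2, h | h | h⟩ <;>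
  rcases h with h | h | h | h | h | h | h | h | h <;> omega

theorem LinkOffset.eq_of_two (hn : n = 4 * q + 2 * s) (hq : q = 5)
    {w : ℕ} (h : LinkOffset n q s 2 w) : w = 4 ∨ w = 6 ∨ w = n - 2 ∨ w = n - 4 := by
  rcases h with ⟨h0, h1, h2, h | h | h⟩ | ⟨h0, h1, h2, h | h | h⟩ <;>
  rcases h with h | h | h | h | h | h | h | h | h <;> omega

theorem linkOffset_q_iff (hn : n = 4 * q + 2 * s) (hq : 3 ≤ q) (hodd : q % 2 = 1)
    {w : ℕ} : LinkOffset n q s q w ↔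
      w = n - 1 ∨ w = 2 * q - 1 ∨ w = q - 1 ∨ w = 2 * q ∨ w = n - q := by
  constructor
  · intro h
    rcases h with ⟨h0, h1, h2, h | h | h⟩ | ⟨h0, h1, h2, h | h | h⟩ <;>
    rcases h with h | h | h | h | h | h | h | h | h <;> omega
  · rintro (rfl | rfl | rfl | rfl | rfl)
    · exact Or.inl ⟨by omega, by omega, by omega, Or.inr (Or.inr (by unfold TriangleType; omega))⟩
    · exact Or.inl ⟨by omega, by omega, by omega, Or.inl (by unfold TriangleType; omega)⟩
    · exact Or.inr ⟨by omega, by omega, by omega, Or.inl (by unfold TriangleType; omega)⟩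
    · exact Or.inl ⟨by omega, by omega, by omega, Or.inl (by unfold TriangleType; omega)⟩
    · exact Or.inl ⟨by omega, by omega, by omega, Or.inr (Or.inr (by unfold TriangleType; omega))⟩

theorem LinkOffset.eq_of_q_add_one (hn : n = 4 * q + 2 * s) (hq : 3 ≤ q) (hodd : q % 2 = 1)
    {w : ℕ} (h : LinkOffset n q s (q + 1) w) :
    w = 1 ∨ w = 2 * q ∨ w = n + 1 - q ∨ w = q - 1 ∨ w = 2 := by
  rcases h with ⟨h0, h1, h2, h | h | h⟩ | ⟨h0, h1, h2, h | h | h⟩ <;>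
  rcases h with h | h | h | h | h | h | h | h | h <;> omega

end

section

variable {n q s : ℕ} {K : PreAbstractSimplicialComplex (ZMod n)}

theorem edgeDegree_q [NeZero n] (hn : n = 4 * q + 2 * s) (hq : 3 ≤ q)
    (hodd : q % 2 = 1) (hK : ModelledOn K q s) : edgeDegree K 0 q = 5 := by
  have hmem : ∀ w, LinkOffset n q s q w ↔
      w ∈ ({n - 1, 2 * q - 1, q - 1, 2 * q, n - q} : Finset ℕ) := by
    intro w
    rw [linkOffset_q_iff hn hq hodd]
    simp
  have hc : ({n - 1, 2 * q - 1, q - 1, 2 * q, n - q} : Finset ℕ).card = 5 := by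
    repeat rw [Finset.card_insert_of_notMem (by
      simp only [Finset.mem_insert, Finset.mem_singleton]; omega)]
    rw [Finset.card_singleton]
  apply le_antisymm
  · rw [← hc]
    exact edgeDegree_le hn hq hodd hK (by omega) (by omega) _ fun w => (hmem w).1
  · rw [← hc]
    exact le_edgeDegree hn hq hodd hK (by omega) (by omega) _ fun w => (hmem w).2

theorem edgeDegree_ne_five_of_subset [NeZero n] (hn : n = 4 * q + 2 * s) (hq : 3 ≤ q)
    (hodd : q % 2 = 1) (hK : ModelledOn K q s) {d : ℕ} (hd0 : 0 < d) (hd : d < n)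
    (a b c e : ℕ) (h : ∀ w, LinkOffset n q s d w → w = a ∨ w = b ∨ w = c ∨ w = e) :
    edgeDegree K 0 d ≠ 5 := by
  have := edgeDegree_le hn hq hodd hK hd0 hd {a, b, c, e} (by simpa using h)
  have := Finset.card_le_four (a := a) (b := b) (c := c) (d := e)
  omega

theorem linkOffset_of_fst {d w : ℕ} (hd : 0 < d) (hdw : d < w) (hw : w < n)
    (h : TriangleType q s d (w - d)) : LinkOffset n q s d w :=
  Or.inl ⟨hd, hdw, hw, Or.inl h⟩

theorem linkOffset_of_last {d w : ℕ} (hd : 0 < d) (hdw : d < w) (hw : w < n)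
    (h : TriangleType q s (n - w) d) : LinkOffset n q s d w :=
  Or.inl ⟨hd, hdw, hw, Or.inr (Or.inr h)⟩

theorem linkOffset_of_lt {d w : ℕ} (hw : 0 < w) (hdw : w < d) (hd : d < n)
    (h : TriangleType q s w (d - w)) : LinkOffset n q s d w :=
  Or.inr ⟨hw, hdw, hd, Or.inl h⟩

theorem edgeDegree_one_ne_five [NeZero n] (hn : n = 4 * q + 2 * s) (hq : 3 ≤ q)
    (hodd : q % 2 = 1) (hK : ModelledOn K q s) : edgeDegree K 0 (1 : ℕ) ≠ 5 := by
  rcases Nat.eq_zero_or_pos s with hs | hs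
  · exact edgeDegree_ne_five_of_subset hn hq hodd hK one_pos (by omega) _ _ _ _
      fun w => LinkOffset.eq_of_one hn hq hodd hs
  · have H : ∀ w, 2 * q ≤ w → w ≤ 2 * q + 3 → LinkOffset n q s 1 w := fun w h1 h2 =>
      linkOffset_of_fst one_pos (by omega) (by omega) (by
        right; right; right; right; right; right; right; right; omega)
    have := six_le_edgeDegree hn hq hodd hK one_pos (by omega)
      (q + 1) (2 * q) (2 * q + 1) (2 * q + 2) (2 * q + 3) (n + 1 - q) (by omega)
      (linkOffset_of_fst (by omega) (by omega) (by omega) (by right; right; left; omega))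
      (H _ (by omega) (by omega)) (H _ (by omega) (by omega)) (H _ (by omega) (by omega))
      (H _ (by omega) (by omega))
      (linkOffset_of_last (by omega) (by omega) (by omega)
        (by right; right; right; left; omega))
    omega

theorem edgeDegree_two_ne_five [NeZero n] (hn : n = 4 * q + 2 * s) (hq : 5 ≤ q)
    (hodd : q % 2 = 1) (hK : ModelledOn K q s) : edgeDegree K 0 (2 : ℕ) ≠ 5 := by
  by_cases h5 : q = 5
  · exact edgeDegree_ne_five_of_subset hn (by omega) hodd hK two_pos (by omega) _ _ _ _
      fun w => LinkOffset.eq_of_two hn h5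
  · have h1 : ∀ j, 2 ≤ j → j ≤ 6 → j % 2 = 0 → LinkOffset n q s 2 (j + 2) := fun j _ _ _ =>
      linkOffset_of_fst two_pos (by omega) (by omega) (by
        right; right; right; right; right; right; left; omega)
    have h2 : ∀ j, 2 ≤ j → j ≤ 6 → j % 2 = 0 → LinkOffset n q s 2 (n - j) := fun j _ _ _ =>
      linkOffset_of_last two_pos (by omega) (by omega) (by
        right; right; right; right; right; right; right; left; omega)
    have := six_le_edgeDegree hn (by omega) hodd hK two_pos (by omega)
      4 6 8 (n - 6) (n - 4) (n - 2) (by omega) (h1 2 (by omega) (by omega) rfl)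
      (h1 4 (by omega) (by omega) rfl) (h1 6 (by omega) (by omega) rfl)
      (h2 6 (by omega) (by omega) rfl) (h2 4 (by omega) (by omega) rfl)
      (h2 2 (by omega) (by omega) rfl)
    omega

theorem edgeDegree_q_sub_one_ne_five [NeZero n] (hn : n = 4 * q + 2 * s) (hq : 3 ≤ q)
    (hodd : q % 2 = 1) (hK : ModelledOn K q s) : edgeDegree K 0 (q - 1 : ℕ) ≠ 5 := by
  have h0 : 0 < q - 1 := by omega
  have := six_le_edgeDegree hn hq hodd hK h0 (by omega)
    q (q + 1) (2 * q) (n - q - 1) (n - q) (n - 2) (by omega)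
    (linkOffset_of_fst h0 (by omega) (by omega) (by
        right; right; right; left; omega))
    (linkOffset_of_fst h0 (by omega) (by omega) (by
        right; right; right; right; right; right; right; left; omega))
    (linkOffset_of_fst h0 (by omega) (by omega) (by right; left; omega))
    (linkOffset_of_last h0 (by omega) (by omega) (by left; omega))
    (linkOffset_of_last h0 (by omega) (by omega) (by
        right; right; right; right; left; omega))
    (linkOffset_of_last h0 (by omega) (by omega) (by
        right; right; right; right; right; right; left; omega))
  omega

theorem edgeDegree_two_mul_q_ne_five [NeZero n] (hn : n = 4 * q + 2 * s) (hq : 3 ≤ q)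
    (hodd : q % 2 = 1) (hK : ModelledOn K q s) : edgeDegree K 0 (2 * q : ℕ) ≠ 5 := by
  have hd : 2 * q < n := by omega
  have := six_le_edgeDegree hn hq hodd hK (by omega) hd
    1 (q - 1) q (q + 1) (2 * q - 1) (n - 1) (by omega)
    (linkOffset_of_lt (by omega) (by omega) hd (by
        right; right; right; right; right; right; right; right; omega))
    (linkOffset_of_lt (by omega) (by omega) hd (by right; left; omega))
    (linkOffset_of_lt (by omega) (by omega) hd (by
        right; right; right; right; right; left; omega))
    (linkOffset_of_lt (by omega) (by omega) hd (by left; omega))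
    (Or.inr ⟨by omega, by omega, hd, Or.inr (Or.inl (by
        right; right; right; right; right; right; right; right; omega))⟩)
    (linkOffset_of_last (by omega) (by omega) (by omega) (by
        right; right; right; right; right; right; right; right; omega))
  omega

/-- Apart from the differences `q` and `q + 1`, edges have degree at most four or at least six. -/
theorem eq_of_edgeDegree_eq_five [NeZero n] (hn : n = 4 * q + 2 * s) (hq : 3 ≤ q)
    (hodd : q % 2 = 1) (hK : ModelledOn K q s) {d : ℕ} (hd0 : 0 < d) (hd : d ≤ 2 * q + s)
    (h5 : edgeDegree K 0 d = 5) : d = q ∨ d = q + 1 := by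
  by_contra! hne
  have hle := edgeDegree_ne_five_of_subset hn hq hodd hK hd0 (by omega)
  by_cases h1 : d = 1
  · exact edgeDegree_one_ne_five hn hq hodd hK (h1 ▸ h5)
  by_cases h2 : d = q - 1
  · exact edgeDegree_q_sub_one_ne_five hn hq hodd hK (h2 ▸ h5)
  by_cases h3 : d = 2
  · exact edgeDegree_two_ne_five hn (by omega) hodd hK (h3 ▸ h5)
  by_cases h4 : d + 2 ≤ 2 * q
  · exact hle _ _ _ _
      (fun w => LinkOffset.eq_of_small hn hodd (by omega) h4 h2 hne.1 hne.2) h5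
  by_cases h6 : d = 2 * q - 1
  · refine hle (n - 1) q (2 * q) (2 * q) (fun w h => ?_) h5
    have := LinkOffset.eq_of_two_mul_sub_one hn hq hodd (h6 ▸ h)
    tauto
  by_cases h7 : d = 2 * q
  · exact edgeDegree_two_mul_q_ne_five hn hq hodd hK (h7 ▸ h5)
  · exact hle _ _ _ _ (fun w => LinkOffset.eq_of_large hn hq (by omega) hd) h5

theorem edgeLink_comm (u v : ZMod n) : edgeLink K u v = edgeLink K v u := by
  ext w
  have h : ({u, v, w} : Finset (ZMod n)) = {v, u, w} := by ext; simp; tauto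
  simp only [edgeLink, Set.mem_ofPred_eq, h]
  tauto

theorem edgeDegree_comm (u v : ZMod n) : edgeDegree K u v = edgeDegree K v u := by
  rw [edgeDegree, edgeLink_comm, edgeDegree]

theorem apply_mem_edgeLink_iff {σ : Equiv.Perm (ZMod n)} (hσ : σ ∈ K.autGroup) {u v w : ZMod n} :
    σ w ∈ edgeLink K (σ u) (σ v) ↔ w ∈ edgeLink K u v := by
  have h := hσ {u, v, w}
  simp only [Finset.map_insert, Finset.map_singleton, Equiv.coe_toEmbedding] at h
  simp only [edgeLink, Set.mem_ofPred_eq, h, ne_eq, EmbeddingLike.apply_eq_iff_eq]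

theorem edgeDegree_apply {σ : Equiv.Perm (ZMod n)} (hσ : σ ∈ K.autGroup) (u v : ZMod n) :
    edgeDegree K (σ u) (σ v) = edgeDegree K u v := by
  have h : edgeLink K (σ u) (σ v) = σ '' edgeLink K u v := by
    ext w
    rw [Equiv.image_eq_preimage_symm, Set.mem_preimage, ← apply_mem_edgeLink_iff hσ (u := u),
      Equiv.apply_symm_apply]
  rw [edgeDegree, h, Set.ncard_image_of_injective _ σ.injective, edgeDegree]

theorem addRight_mem_autGroup (hK : ModelledOn K q s) (c : ZMod n) :
    (Equiv.addRight c : Equiv.Perm (ZMod n)) ∈ K.autGroup := by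
  have key : ∀ (c : ZMod n) (t : Finset (ZMod n)), t ∈ K.faces →
      t.map (Equiv.addRight c).toEmbedding ∈ K.faces := by
    intro c t ht
    obtain ⟨h0, x, a, b, d, hF, hsub⟩ := (hK t).1 ht
    refine (hK _).2 ⟨h0.map, x + c, a, b, d, hF, ?_⟩
    intro y hy
    obtain ⟨z, hz, rfl⟩ := Finset.mem_map.1 hy
    have := hsub hz
    simp only [quad, Finset.mem_insert, Finset.mem_singleton, Equiv.coe_toEmbedding,
      Equiv.coe_addRight] at this ⊢
    rcases this with rfl | rfl | rfl | rfl <;> simp [add_right_comm]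
  intro t
  refine ⟨fun h => ?_, key c t⟩
  have h' := key (-c) _ h
  rw [Finset.map_map] at h'
  convert h' using 1
  ext y
  simp

theorem edgeDegree_eq_zero_left (hK : ModelledOn K q s) (u v : ZMod n) :
    edgeDegree K u v = edgeDegree K 0 (v - u) := by
  have := edgeDegree_apply (addRight_mem_autGroup hK u) 0 (v - u)
  simpa using this

theorem mem_edgeLink_iff_sub (hK : ModelledOn K q s) (u v w : ZMod n) :
    w ∈ edgeLink K u v ↔ w - u ∈ edgeLink K 0 (v - u) := by
  have := apply_mem_edgeLink_iff (addRight_mem_autGroup hK u) (u := 0) (v := v - u) (w := w - u)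
  simpa using this

/-- The edges of degree five have difference `±q` or `±(q + 1)`. -/
theorem sub_eq_of_edgeDegree_eq_five [NeZero n] (hn : n = 4 * q + 2 * s) (hq : 3 ≤ q)
    (hodd : q % 2 = 1) (hK : ModelledOn K q s) {u v : ZMod n} (huv : u ≠ v)
    (h5 : edgeDegree K u v = 5) :
    v - u = q ∨ u - v = q ∨ v - u = (q + 1 : ℕ) ∨ u - v = (q + 1 : ℕ) := by
  have key : ∀ {u v : ZMod n}, u ≠ v → edgeDegree K u v = 5 → (v - u).val ≤ 2 * q + s →
      v - u = q ∨ v - u = (q + 1 : ℕ) := by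
    intro u v huv h5 hle
    rw [edgeDegree_eq_zero_left hK, ← ZMod.natCast_zmod_val (v - u)] at h5
    have h0 : 0 < (v - u).val := by
      rw [Nat.pos_iff_ne_zero, Ne, ZMod.val_eq_zero, sub_eq_zero]
      exact huv.symm
    rw [← ZMod.natCast_zmod_val (v - u)]
    rcases eq_of_edgeDegree_eq_five hn hq hodd hK h0 hle h5 with h | h
    · left; rw [h]
    · right; rw [h]
  by_cases hle : (v - u).val ≤ 2 * q + s
  · have := key huv h5 hle
    tauto
  · have hval : (u - v).val = n - (v - u).val := by
      have : NeZero (v - u) := ⟨sub_ne_zero.2 huv.symm⟩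
      rw [← neg_sub v u, ZMod.val_neg_of_ne_zero]
    have := key huv.symm (edgeDegree_comm (K := K) u v ▸ h5) (by rw [hval]; omega)
    tauto

/-- A description, invariant under automorphisms, of the edges with difference `±q`: they have
degree five and both of their end points have a further edge of degree five in a common
triangle. -/
def IsRigidEdge (K : PreAbstractSimplicialComplex (ZMod n)) (u v : ZMod n) : Prop :=
  u ≠ v ∧ edgeDegree K u v = 5 ∧ (∃ w ∈ edgeLink K u v, edgeDegree K u w = 5) ∧
    ∃ w ∈ edgeLink K u v, edgeDegree K v w = 5

theorem IsRigidEdge.symm {u v : ZMod n} (h : IsRigidEdge K u v) : IsRigidEdge K v u := by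
  obtain ⟨h1, h2, h3, h4⟩ := h
  refine ⟨h1.symm, by rwa [edgeDegree_comm], ?_, ?_⟩ <;> rwa [edgeLink_comm]

theorem IsRigidEdge.apply {σ : Equiv.Perm (ZMod n)} (hσ : σ ∈ K.autGroup) {u v : ZMod n}
    (h : IsRigidEdge K u v) : IsRigidEdge K (σ u) (σ v) := by
  obtain ⟨h1, h2, ⟨w, hw, hw'⟩, w', hw1, hw2⟩ := h
  exact ⟨σ.injective.ne h1, by rwa [edgeDegree_apply hσ],
    ⟨σ w, (apply_mem_edgeLink_iff hσ).2 hw, by rwa [edgeDegree_apply hσ]⟩,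
    σ w', (apply_mem_edgeLink_iff hσ).2 hw1, by rwa [edgeDegree_apply hσ]⟩

theorem isRigidEdge_add_q [NeZero n] (hn : n = 4 * q + 2 * s) (hq : 3 ≤ q)
    (hodd : q % 2 = 1) (hK : ModelledOn K q s) (u : ZMod n) : IsRigidEdge K u (u + q) := by
  have h5 : ∀ v : ZMod n, edgeDegree K v (v + q) = 5 := fun v => by
    rw [edgeDegree_eq_zero_left hK, add_sub_cancel_left, edgeDegree_q hn hq hodd hK]
  have hlink : ∀ w : ℕ, w < n → LinkOffset n q s q w → u + w ∈ edgeLink K u (u + q) := by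
    intro w hw h
    rw [mem_edgeLink_iff_sub hK, add_sub_cancel_left, add_sub_cancel_left,
      natCast_mem_edgeLink_iff hn hq hodd hK (by omega) (by omega) hw]
    exact h
  refine ⟨?_, h5 u, ⟨_, hlink (n - q) (by omega) ?_, ?_⟩, _, hlink (2 * q) (by omega) ?_, ?_⟩
  · intro h
    have : ((0 : ℕ) : ZMod n) = q := by
      rw [Nat.cast_zero]; exact (left_eq_add.1 h).symm
    have := natCast_injOn (by omega) (by omega) this
    omega
  · rw [linkOffset_q_iff hn hq hodd]; tauto
  · have h := h5 (u + (n - q : ℕ))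
    have h0 : (((n - q : ℕ) : ZMod n) + q) = 0 := by
      rw [← Nat.cast_add, natCast_eq_of_eq_add_self (b := 0) (by omega), Nat.cast_zero]
    rwa [add_assoc, h0, add_zero, edgeDegree_comm] at h
  · rw [linkOffset_q_iff hn hq hodd]; tauto
  · have := h5 (u + q)
    rwa [add_assoc, ← Nat.cast_add, ← two_mul] at this

theorem not_isRigidEdge_add_q_add_one [NeZero n] (hn : n = 4 * q + 2 * s) (hq : 3 ≤ q)
    (hodd : q % 2 = 1) (hK : ModelledOn K q s) {u v : ZMod n} (huv : v - u = (q + 1 : ℕ)) :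
    ¬ IsRigidEdge K u v := by
  rintro ⟨-, -, ⟨w, hw, hw5⟩, -⟩
  have hwu : u ≠ w := hw.1.symm
  rw [mem_edgeLink_iff_sub hK, huv, ← ZMod.natCast_zmod_val (w - u),
    natCast_mem_edgeLink_iff hn hq hodd hK (by omega) (by omega) (ZMod.val_lt _)] at hw
  have hcases := hw.eq_of_q_add_one hn hq hodd
  have hneg : ∀ m : ℕ, m ≤ n → u - w = m → w - u = (n - m : ℕ) := by
    intro m hm h
    rw [Nat.cast_sub hm, ZMod.natCast_self, ← h]; ring
  have hval : ∀ m : ℕ, m < n → w - u = m → (w - u).val = m := by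
    intro m hm h
    rw [h, ZMod.val_natCast, Nat.mod_eq_of_lt hm]
  rcases sub_eq_of_edgeDegree_eq_five hn hq hodd hK hwu hw5 with h | h | h | h
  · have := hval _ (by omega) h; omega
  · have := hval _ (by omega) (hneg _ (by omega) h); omega
  · have := hval _ (by omega) h; omega
  · have := hval _ (by omega) (hneg _ (by omega) h); omega

theorem isRigidEdge_iff [NeZero n] (hn : n = 4 * q + 2 * s) (hq : 3 ≤ q)
    (hodd : q % 2 = 1) (hK : ModelledOn K q s) {u v : ZMod n} :
    IsRigidEdge K u v ↔ v = u + q ∨ v = u - q := by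
  constructor
  · intro h
    rcases sub_eq_of_edgeDegree_eq_five hn hq hodd hK h.1 h.2.1 with h' | h' | h' | h'
    · exact Or.inl (by rw [← h']; ring)
    · exact Or.inr (by rw [← h']; ring)
    · exact absurd h (not_isRigidEdge_add_q_add_one hn hq hodd hK h')
    · exact absurd h.symm (not_isRigidEdge_add_q_add_one hn hq hodd hK h')
  · rintro (rfl | rfl)
    · exact isRigidEdge_add_q hn hq hodd hK u
    · have := (isRigidEdge_add_q hn hq hodd hK (u - q)).symm
      rwa [sub_add_cancel] at this

end

/-! ### Automorphisms are rotations -/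

section

variable {n q s : ℕ} {K : PreAbstractSimplicialComplex (ZMod n)}

theorem add_natCast_mem_edgeLink_add_q_iff [NeZero n] (hn : n = 4 * q + 2 * s) (hq : 3 ≤ q)
    (hodd : q % 2 = 1) (hK : ModelledOn K q s) (u : ZMod n) {w : ℕ} (hw : w < n) :
    u + w ∈ edgeLink K u (u + q) ↔
      w = n - 1 ∨ w = 2 * q - 1 ∨ w = q - 1 ∨ w = 2 * q ∨ w = n - q := by
  rw [mem_edgeLink_iff_sub hK, add_sub_cancel_left, add_sub_cancel_left,
    natCast_mem_edgeLink_iff hn hq hodd hK (by omega) (by omega) hw, linkOffset_q_iff hn hq hodd]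

/-- The vertices that span triangles with two consecutive edges of difference `q`. For `s = 0`
the next vertex `u + 3 q` on the line is one of them. -/
theorem eq_of_mem_edgeLink_of_mem_edgeLink [NeZero n] (hn : n = 4 * q + 2 * s) (hq : 3 ≤ q)
    (hodd : q % 2 = 1) (hK : ModelledOn K q s) {u w : ZMod n} (h1 : w ∈ edgeLink K u (u + q))
    (h2 : w ∈ edgeLink K (u + q) (u + q + q)) (h3 : n = 4 * q → w ≠ u + (3 * q : ℕ)) :
    w = u + (q - 1 : ℕ) ∨ w = u + (2 * q - 1 : ℕ) := by
  obtain ⟨a, ha, rfl⟩ : ∃ a : ℕ, a < n ∧ w = u + a :=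
    ⟨(w - u).val, ZMod.val_lt _, by rw [ZMod.natCast_zmod_val]; ring⟩
  obtain ⟨b, hb, hab⟩ : ∃ b : ℕ, b < n ∧ u + a = u + q + b :=
    ⟨(u + a - (u + q)).val, ZMod.val_lt _, by rw [ZMod.natCast_zmod_val]; ring⟩
  rw [hab, add_natCast_mem_edgeLink_add_q_iff hn hq hodd hK _ hb] at h2
  rw [add_natCast_mem_edgeLink_add_q_iff hn hq hodd hK _ ha] at h1
  have hab' : a = q + b ∨ a + n = q + b := by
    rw [add_assoc, ← Nat.cast_add] at hab
    have hab := add_left_cancel hab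
    by_cases hlt : q + b < n
    · exact Or.inl (natCast_injOn ha hlt hab)
    · right
      have h4 : ((q + b : ℕ) : ZMod n) = (q + b - n : ℕ) :=
        natCast_eq_of_eq_add_self (by omega)
      have := natCast_injOn ha (by omega) (hab.trans h4)
      omega
  have h4 : n = 4 * q → a ≠ 3 * q := by
    rintro h rfl
    exact h3 h rfl
  have h5 : a = q - 1 ∨ a = 2 * q - 1 := by omega
  rcases h5 with rfl | rfl
  · exact Or.inl rfl
  · exact Or.inr rfl

/-- If an automorphism maps the path `x, x + q, x + 2 q` to a path `u, u + q, u + 2 q`, in either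
direction, then it maps the two common neighbours of its edges to each other. -/
theorem apply_eq_of_line [NeZero n] (hn : n = 4 * q + 2 * s) (hq : 3 ≤ q)
    (hodd : q % 2 = 1) (hK : ModelledOn K q s) {σ : Equiv.Perm (ZMod n)} (hσ : σ ∈ K.autGroup)
    {x u : ZMod n} (h : (σ x = u ∧ σ (x + q) = u + q ∧ σ (x + q + q) = u + q + q ∧
        (n = 4 * q → σ (x + (3 * q : ℕ)) = u + (3 * q : ℕ))) ∨
      (σ x = u + q + q ∧ σ (x + q) = u + q ∧ σ (x + q + q) = u ∧
        (n = 4 * q → σ (x + (3 * q : ℕ)) = u + (3 * q : ℕ))))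
    {a : ℕ} (ha : a = q - 1 ∨ a = 2 * q - 1) :
    σ (x + a) = u + (q - 1 : ℕ) ∨ σ (x + a) = u + (2 * q - 1 : ℕ) := by
  have m1 : x + a ∈ edgeLink K x (x + q) :=
    (add_natCast_mem_edgeLink_add_q_iff hn hq hodd hK _ (by omega)).2 (by omega)
  have m2 : x + a ∈ edgeLink K (x + q) (x + q + q) := by
    rcases ha with rfl | rfl
    · have e : x + (q - 1 : ℕ) = x + q + (n - 1 : ℕ) := by
        rw [add_assoc, ← Nat.cast_add, natCast_eq_of_eq_add_self (a := q + (n - 1)) (b := q - 1)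
          (by omega)]
      rw [e]
      exact (add_natCast_mem_edgeLink_add_q_iff hn hq hodd hK _ (by omega)).2 (by omega)
    · have e : x + (2 * q - 1 : ℕ) = x + q + (q - 1 : ℕ) := by
        rw [add_assoc, ← Nat.cast_add]; congr 2; omega
      rw [e]
      exact (add_natCast_mem_edgeLink_add_q_iff hn hq hodd hK _ (by omega)).2 (by omega)
  rw [← apply_mem_edgeLink_iff hσ] at m1 m2
  have h3 : (n = 4 * q → σ (x + (3 * q : ℕ)) = u + (3 * q : ℕ)) →
      n = 4 * q → σ (x + a) ≠ u + (3 * q : ℕ) := by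
    intro h h4 h5
    have := natCast_injOn (by omega) (by omega)
      (add_left_cancel (σ.injective (h5.trans (h h4).symm)))
    omega
  rcases h with ⟨e1, e2, e3, e4⟩ | ⟨e1, e2, e3, e4⟩
  · rw [e1, e2] at m1
    rw [e2, e3] at m2
    exact eq_of_mem_edgeLink_of_mem_edgeLink hn hq hodd hK m1 m2 (h3 e4)
  · rw [e1, e2, edgeLink_comm] at m1
    rw [e2, e3, edgeLink_comm] at m2
    exact eq_of_mem_edgeLink_of_mem_edgeLink hn hq hodd hK m2 m1 (h3 e4)

/-- Every automorphism is a rotation. An automorphism preserves the lines of difference `q`, and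
if it reversed one of them it would satisfy `σ (x - 1) = σ x + q - 1` for all `x`, which is
impossible for parity reasons. -/
theorem exists_eq_addRight_of_mem_autGroup [NeZero n] (hn : n = 4 * q + 2 * s) (hq : 3 ≤ q)
    (hodd : q % 2 = 1) (hK : ModelledOn K q s) {σ : Equiv.Perm (ZMod n)} (hσ : σ ∈ K.autGroup) :
    ∃ c, σ = Equiv.addRight c := by
  have hcast : ∀ {a : ℕ}, 0 < a → a < n → (a : ZMod n) ≠ 0 := fun h0 h1 h => by
    have := natCast_injOn h1 (by omega) (h.trans Nat.cast_zero.symm)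
    omega
  have h2q : (q : ZMod n) + q ≠ 0 := by
    rw [← Nat.cast_add]; exact hcast (by omega) (by omega)
  have c1 : ((q - 1 : ℕ) : ZMod n) = q - 1 := by rw [Nat.cast_sub (by omega), Nat.cast_one]
  have c2 : ((2 * q - 1 : ℕ) : ZMod n) = q + q - 1 := by
    rw [Nat.cast_sub (by omega), Nat.cast_one, two_mul, Nat.cast_add]
  have c3 : ((3 * q : ℕ) : ZMod n) = q + q + q := by push_cast; ring
  have c4 : n = 4 * q → (q + q + q + q : ZMod n) = 0 := by
    intro h
    rw [← ZMod.natCast_self n, h]; push_cast; ring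
  have hsign : ∀ x, σ (x + q) = σ x + q ∨ σ (x + q) = σ x - q := fun x =>
    (isRigidEdge_iff hn hq hodd hK).1 ((isRigidEdge_add_q hn hq hodd hK x).apply hσ)
  -- the direction of `σ` is constant along a line
  have hplus : ∀ x, σ (x + q) = σ x + q → σ (x + q + q) = σ (x + q) + q := by
    intro x h
    refine (hsign (x + q)).resolve_right fun h' => ?_
    rw [h, add_sub_cancel_right] at h'
    have := σ.injective h'
    rw [add_assoc] at this
    exact h2q (left_eq_add.1 this.symm)
  have hminus : ∀ x, σ (x + q) = σ x - q → σ (x + q + q) = σ (x + q) - q := by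
    intro x h
    refine (hsign (x + q)).resolve_left fun h' => ?_
    rw [h, sub_add_cancel] at h'
    have := σ.injective h'
    rw [add_assoc] at this
    exact h2q (left_eq_add.1 this.symm)
  have plus : ∀ x, σ (x + q) = σ x + q → σ (x + q + q - 1) = σ x + q + q - 1 := by
    intro x h
    have h1 := hplus _ h
    have h2 := hplus _ h1
    have h3 := hplus _ h2
    have A := apply_eq_of_line hn hq hodd hK hσ (x := x) (u := σ x)
      (Or.inl ⟨rfl, h, by rw [h1, h], fun _ => by
        rw [c3, ← add_assoc, ← add_assoc, h2, h1, h]; ring⟩) (a := 2 * q - 1) (Or.inr rfl)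
    have B := apply_eq_of_line hn hq hodd hK hσ (x := x + q) (u := σ x + q)
      (Or.inl ⟨h, by rw [h1, h], by rw [h2, h1, h], fun _ => by
        rw [c3, ← add_assoc, ← add_assoc, h3, h2, h1, h]; ring⟩) (a := q - 1) (Or.inl rfl)
    rw [c2, c1] at A
    rw [c2, c1] at B
    have e1 : x + (q + q - 1) = x + q + q - 1 := by ring
    have e2 : x + q + (q - 1) = x + q + q - 1 := by ring
    rw [e1] at A
    rw [e2] at B
    rcases A with A | A
    · rcases B with B | B
      · rw [B]; ring
      · exact absurd (show (q + q : ZMod n) = 0 by linear_combination A - B) h2q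
    · rw [A]; ring
  have minus : ∀ x, σ (x + q) = σ x - q → σ (x + q + q - 1) = σ x - q - 1 := by
    intro x h
    have h1 := hminus _ h
    have h2 := hminus _ h1
    have h3 := hminus _ h2
    have A := apply_eq_of_line hn hq hodd hK hσ (x := x) (u := σ x - q - q)
      (Or.inr ⟨by ring, by rw [h]; ring, by rw [h1, h], fun h4 => by
        rw [c3, ← add_assoc, ← add_assoc, h2, h1, h]; linear_combination -(c4 h4)⟩)
      (a := 2 * q - 1) (Or.inr rfl)
    have B := apply_eq_of_line hn hq hodd hK hσ (x := x + q) (u := σ x - q - q - q)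
      (Or.inr ⟨by rw [h]; ring, by rw [h1, h]; ring, by rw [h2, h1, h], fun h4 => by
        rw [c3, ← add_assoc, ← add_assoc, h3, h2, h1, h]; linear_combination -(c4 h4)⟩)
      (a := q - 1) (Or.inl rfl)
    rw [c2, c1] at A
    rw [c2, c1] at B
    have e1 : x + (q + q - 1) = x + q + q - 1 := by ring
    have e2 : x + q + (q - 1) = x + q + q - 1 := by ring
    rw [e1] at A
    rw [e2] at B
    rcases A with A | A
    · rw [A]; ring
    · rcases B with B | B
      · exact absurd (show (q + q : ZMod n) = 0 by linear_combination B - A) h2q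
      · rw [B]; ring
  by_cases hex : ∃ x, σ (x + q) = σ x + q
  · obtain ⟨x₀, hx₀⟩ := hex
    have hline : ∀ (j : ℕ) x, σ (x + q) = σ x + q → σ (x + j * q + q) = σ (x + j * q) + q := by
      intro j x h
      induction j with
      | zero => simpa using h
      | succ j ih =>
        have e : x + ((j + 1 : ℕ) : ZMod n) * q = x + j * q + q := by push_cast; ring
        rw [e]
        exact hplus _ ih
    have hprev : ∀ x, σ (x + q) = σ x + q → σ (x - 1 + q) = σ (x - 1) + q := by
      intro x h
      have h1 := plus x h
      have h2 := plus _ (hplus _ h)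
      have h3 : σ (x + q + q - 1 + q) = σ (x + q + q - 1) + q := by
        rw [h1, show x + q + q - 1 + (q : ZMod n) = x + q + q + q - 1 by ring, h2, h]; ring
      have h4 := hline (n - 2) _ h3
      have e : x + q + q - 1 + ((n - 2 : ℕ) : ZMod n) * q = x - 1 := by
        rw [Nat.cast_sub (by omega), ZMod.natCast_self]; push_cast; ring
      rwa [e] at h4
    have hall : ∀ x, σ (x + q) = σ x + q := by
      have : ∀ m : ℕ, σ (x₀ - m + q) = σ (x₀ - m) + q := by
        intro m
        induction m with
        | zero => simpa using hx₀
        | succ m ih =>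
          have e : x₀ - ((m + 1 : ℕ) : ZMod n) = x₀ - m - 1 := by push_cast; ring
          rw [e]
          exact hprev _ ih
      intro x
      have := this (x₀ - x).val
      rwa [ZMod.natCast_zmod_val, sub_sub_cancel] at this
    have hone : ∀ x, σ (x + 1) = σ x + 1 := by
      intro x
      have h1 := plus _ (hall (x + 1))
      rw [show x + 1 + q + q - 1 = x + (q : ZMod n) + q by ring, hall, hall] at h1
      linear_combination -h1
    refine ⟨σ 0, Equiv.ext fun x => ?_⟩
    have : ∀ m : ℕ, σ m = m + σ 0 := by
      intro m
      induction m with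
      | zero => simp
      | succ m ih => rw [Nat.cast_succ, hone, ih]; ring
    have := this x.val
    rwa [ZMod.natCast_zmod_val] at this
  · exfalso
    have hall : ∀ x, σ (x + q) = σ x - q := fun x =>
      (hsign x).resolve_left fun h => hex ⟨x, h⟩
    have hone : ∀ x, σ (x + 1) = σ x - (q - 1) := by
      intro x
      have h1 := minus _ (hall (x + 1))
      rw [show x + 1 + q + q - 1 = x + (q : ZMod n) + q by ring, hall, hall] at h1
      linear_combination -h1
    have hm : ∀ m : ℕ, σ m = σ 0 - m * (q - 1) := by
      intro m
      induction m with
      | zero => simp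
      | succ m ih => rw [Nat.cast_succ, hone, ih]; ring
    have h1 := hm q
    have h2 := hall 0
    rw [zero_add] at h2
    have h3 : ((q * (q - 2) : ℕ) : ZMod n) = 0 := by
      rw [Nat.cast_mul, Nat.cast_sub (by omega)]
      push_cast
      linear_combination h1 - h2
    rw [ZMod.natCast_eq_zero_iff] at h3
    have h4 : 2 ∣ q * (q - 2) := (Dvd.intro (2 * q + s) (by omega)).trans h3
    rcases (Nat.prime_two.dvd_mul).1 h4 with h | h <;> omega

end

/-! ### Alternating sequences and the companion matrix -/

section

variable {A : Type*} [AddCommGroup A]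

theorem alternating_sum_add_alternating_sum_succ (a : ℕ → A) (m : ℕ) :
    (∑ i ∈ Finset.range m, (-1 : ℤ) ^ i • a i) + ∑ i ∈ Finset.range m, (-1 : ℤ) ^ i • a (i + 1) =
      a 0 - (-1 : ℤ) ^ m • a m := by
  induction m with
  | zero => simp
  | succ m ih =>
    rw [Finset.sum_range_succ, Finset.sum_range_succ, add_add_add_comm, ih, pow_succ]
    simp only [mul_neg, mul_one, neg_smul]
    abel

theorem sum_range_two_mul_add_one_alternating (a : ℕ → A) (m : ℕ) :
    ∑ i ∈ Finset.range (2 * m + 1), (-1 : ℤ) ^ i • a i =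
      a 0 - ∑ i ∈ Finset.range m, (a (2 * i + 1) - a (2 * i + 2)) := by
  induction m with
  | zero => simp
  | succ m ih =>
    rw [show 2 * (m + 1) + 1 = 2 * m + 1 + 1 + 1 by ring, Finset.sum_range_succ,
      Finset.sum_range_succ, ih, Finset.sum_range_succ, Odd.neg_one_pow ⟨m, rfl⟩,
      Even.neg_one_pow ⟨m + 1, by ring⟩]
    simp only [neg_smul, one_smul]
    abel

end

/-- The standard basis vector with index `j`, for `j < q - 1`. -/
def unitVec (q j : ℕ) : Fin (q - 1) → ℤ := fun i => if (i : ℕ) = j then 1 else 0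

theorem unitVec_eq_single {q : ℕ} (j : Fin (q - 1)) : unitVec q j = Pi.single j 1 := by
  ext i
  simp [unitVec, Pi.single_apply, Fin.ext_iff]

theorem companionMatrix_mulVec_unitVec {q j : ℕ} (hj : j < q - 1) :
    (companionMatrix q).mulVec (unitVec q j) = fun i => companionMatrix q i ⟨j, hj⟩ := by
  rw [show unitVec q j = Pi.single ⟨j, hj⟩ 1 from unitVec_eq_single ⟨j, hj⟩,
    Matrix.mulVec_single_one]
  rfl

/-- The orbit of the first standard basis vector under the companion matrix. -/
def companionOrbit (q x : ℕ) : Fin (q - 1) → ℤ := (companionMatrix q ^ x).mulVec (unitVec q 0)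

theorem companionOrbit_add (q x y : ℕ) :
    companionOrbit q (x + y) = (companionMatrix q ^ x).mulVec (companionOrbit q y) := by
  rw [companionOrbit, companionOrbit, Matrix.mulVec_mulVec, pow_add]

theorem companionOrbit_of_lt {q x : ℕ} (hx : x < q - 1) : companionOrbit q x = unitVec q x := by
  induction x with
  | zero => simp [companionOrbit]
  | succ x ih =>
    rw [add_comm, companionOrbit_add, ih (by omega), pow_one,
      companionMatrix_mulVec_unitVec (by omega)]
    ext i
    have h : x + 1 ≠ q - 1 := by omega
    simp [companionMatrix, unitVec, h, add_comm]

theorem companionOrbit_of_add_one_eq {q x : ℕ} (hq : 3 ≤ q) (hx : x + 1 = q) :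
    companionOrbit q x = fun i : Fin (q - 1) => (-1 : ℤ) ^ ((i : ℕ) + 1) := by
  obtain ⟨p, rfl⟩ : ∃ p, x = 1 + p := ⟨x - 1, by omega⟩
  rw [companionOrbit_add, companionOrbit_of_lt (by omega), pow_one,
    companionMatrix_mulVec_unitVec (by omega)]
  ext i
  have h : p + 1 = q - 1 := by omega
  simp [companionMatrix, h]

/-- The last column of the companion matrix makes the alternating sum of `q` consecutive vectors of
the orbit vanish. -/
theorem companionOrbit_alternating_sum {q : ℕ} (hq : 3 ≤ q) (hodd : q % 2 = 1) (x : ℕ) :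
    ∑ i ∈ Finset.range q, (-1 : ℤ) ^ i • companionOrbit q (x + i) = 0 := by
  have h0 : ∑ i ∈ Finset.range q, (-1 : ℤ) ^ i • companionOrbit q i = 0 := by
    obtain ⟨p, hp⟩ : ∃ p, q = p + 1 := ⟨q - 1, by omega⟩
    have hp' : q - 1 = p := by omega
    have hr : Finset.range q = Finset.range (p + 1) := by rw [hp]
    have hlast := companionOrbit_of_add_one_eq hq hp.symm
    rw [hr, Finset.sum_range_succ, Even.neg_one_pow (Nat.even_iff.2 (by omega)), one_smul]
    ext i
    have hi : (i : ℕ) < p := by omega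
    rw [Pi.add_apply, Finset.sum_apply, Pi.zero_apply,
      Finset.sum_eq_single_of_mem (i : ℕ) (Finset.mem_range.2 hi)]
    · rw [companionOrbit_of_lt i.2, hlast]
      simp [unitVec, pow_succ]
    · intro j hj hji
      rw [companionOrbit_of_lt (by rw [hp']; exact Finset.mem_range.1 hj)]
      simp [unitVec, hji.symm]
  have h1 := congrArg (companionMatrix q ^ x).mulVec h0
  rw [Matrix.mulVec_zero, Matrix.mulVec_sum] at h1
  rw [← h1]
  refine Finset.sum_congr rfl fun i _ => ?_
  rw [Matrix.mulVec_smul, ← companionOrbit_add]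

theorem companionOrbit_add_q {q : ℕ} (hq : 3 ≤ q) (hodd : q % 2 = 1) (x : ℕ) :
    companionOrbit q (x + q) = -companionOrbit q x := by
  have h := alternating_sum_add_alternating_sum_succ (fun i => companionOrbit q (x + i)) q
  have h1 : ∑ i ∈ Finset.range q, (-1 : ℤ) ^ i • companionOrbit q (x + (i + 1)) = 0 := by
    rw [← companionOrbit_alternating_sum hq hodd (x + 1)]
    exact Finset.sum_congr rfl fun i _ => by rw [add_assoc, add_comm 1 i]
  rw [companionOrbit_alternating_sum hq hodd, h1, Odd.neg_one_pow (Nat.odd_iff.2 hodd)] at h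
  simp only [add_zero, neg_smul, one_smul, sub_neg_eq_add] at h
  exact eq_neg_of_add_eq_zero_right h.symm

theorem companionMatrix_pow_q {q : ℕ} (hq : 3 ≤ q) (hodd : q % 2 = 1) :
    companionMatrix q ^ q = -1 := by
  refine Matrix.ext_of_mulVec_single fun j => ?_
  rw [← unitVec_eq_single, Matrix.neg_mulVec, Matrix.one_mulVec, ← companionOrbit_of_lt j.2,
    ← companionOrbit_add, add_comm, companionOrbit_add_q hq hodd]

theorem companionMatrix_pow_two_mul {q : ℕ} (hq : 3 ≤ q) (hodd : q % 2 = 1) :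
    companionMatrix q ^ (2 * q) = 1 := by
  rw [mul_comm, pow_mul, companionMatrix_pow_q hq hodd, neg_one_sq]

theorem det_companionMatrix {q : ℕ} (hq : 3 ≤ q) (hodd : q % 2 = 1) :
    (companionMatrix q).det = 1 := by
  have h : (companionMatrix q).det ^ q = 1 := by
    rw [← Matrix.det_pow, companionMatrix_pow_q hq hodd, Matrix.det_neg, Fintype.card_fin,
      Even.neg_one_pow (Nat.even_iff.2 (by omega)), Matrix.det_one, one_mul]
  have hu : IsUnit (companionMatrix q).det := IsUnit.of_pow_eq_one h (by omega)
  rcases Int.isUnit_iff.1 hu with h1 | h1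
  · exact h1
  · rw [h1, Odd.neg_one_pow (Nat.odd_iff.2 hodd)] at h
    norm_num at h

/-- If the square of the companion matrix were trivial, then the matrix would be `-1`, as its `q`-th
power is. -/
theorem companionMatrix_sq_ne_one {q : ℕ} (hq : 3 ≤ q) (hodd : q % 2 = 1) :
    companionMatrix q ^ 2 ≠ 1 := by
  intro h
  have h1 := companionMatrix_pow_q hq hodd
  have h2 : companionMatrix q ^ q = companionMatrix q := by
    conv_lhs => rw [pow_eq_pow_mod q h, hodd, pow_one]
  rw [h2] at h1
  have h3 := congrFun (congrFun h1 ⟨1, by omega⟩) ⟨0, by omega⟩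
  simp [companionMatrix] at h3

theorem orderOf_companionMatrix {q : ℕ} (hp : q.Prime) (hq : 3 ≤ q) :
    orderOf (companionMatrix q) = 2 * q := by
  have hodd : q % 2 = 1 := Nat.odd_iff.1 (hp.odd_of_ne_two (by omega))
  refine orderOf_eq_of_pow_and_pow_div_prime (by omega) (companionMatrix_pow_two_mul hq hodd) ?_
  intro p hpp hdvd
  rcases (Nat.Prime.dvd_mul hpp).1 hdvd with h | h
  · rw [(Nat.prime_dvd_prime_iff_eq hpp Nat.prime_two).1 h, Nat.mul_div_cancel_left _ two_pos,
      companionMatrix_pow_q hq hodd]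
    intro h
    have := congrFun (congrFun h ⟨0, by omega⟩) ⟨0, by omega⟩
    simp at this
  · rw [(Nat.prime_dvd_prime_iff_eq hpp hp).1 h, Nat.mul_div_cancel _ (by omega)]
    exact companionMatrix_sq_ne_one hq hodd

/-! ### A cocycle with values in an alternating sequence -/

section

variable {n q s : ℕ} {K : PreAbstractSimplicialComplex (ZMod n)} {A : Type*} [AddCommGroup A]

/-- A sequence indexed by `ℤ/n` all of whose alternating sums of `q` consecutive terms vanish. -/
def IsAlternating (q : ℕ) (α : ZMod n → A) : Prop :=
  ∀ x, ∑ i ∈ Finset.range q, (-1 : ℤ) ^ i • α (x + (i : ℕ)) = 0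

theorem IsAlternating.add_q {α : ZMod n → A} (hodd : q % 2 = 1) (hα : IsAlternating q α)
    (x : ZMod n) : α (x + q) = -α x := by
  have h := alternating_sum_add_alternating_sum_succ (fun i : ℕ => α (x + (i : ℕ))) q
  have h1 : ∑ i ∈ Finset.range q, (-1 : ℤ) ^ i • α (x + ((i + 1 : ℕ) : ZMod n)) = 0 := by
    rw [← hα (x + 1)]
    exact Finset.sum_congr rfl fun i _ => by rw [Nat.cast_succ, add_assoc, add_comm (1 : ZMod n)]
  rw [hα x, h1, Odd.neg_one_pow (Nat.odd_iff.2 hodd)] at h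
  simp only [add_zero, neg_smul, one_smul, sub_neg_eq_add, Nat.cast_zero] at h
  exact eq_neg_of_add_eq_zero_right h.symm

/-- The value of the cocycle on the edge from `x` to `x + d`, for `d ≤ q + 1`. -/
def shortSum (α : ZMod n → A) (x : ZMod n) (d : ℕ) : A :=
  ∑ i ∈ Finset.range (d / 2), (α (x + (2 * i + 1 : ℕ)) - α (x + (2 * i + 2 : ℕ)))

/-- The cocycle attached to an alternating sequence `α`: the value on the edge `(u, v)` is
`shortSum α u (v - u)` if `v - u` is in `{0, …, q + 1}`, minus the value on the reversed edge if
`u - v` is, and zero on all longer edges. -/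
def cochain (q : ℕ) (α : ZMod n → A) (e : ZMod n × ZMod n) : A :=
  if (e.2 - e.1).val ≤ q + 1 then shortSum α e.1 (e.2 - e.1).val
  else if (e.1 - e.2).val ≤ q + 1 then -shortSum α e.2 (e.1 - e.2).val
  else 0

@[simp]
theorem shortSum_zero (α : ZMod n → A) (x : ZMod n) : shortSum α x 0 = 0 := rfl

@[simp]
theorem shortSum_one (α : ZMod n → A) (x : ZMod n) : shortSum α x 1 = 0 := rfl

theorem shortSum_two (α : ZMod n → A) (x : ZMod n) :
    shortSum α x 2 = α (x + 1) - α (x + 2) := by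
  simp [shortSum]

theorem shortSum_add_two (α : ZMod n → A) (x : ZMod n) (d : ℕ) :
    shortSum α x (d + 2) = shortSum α x 2 + shortSum α (x + (2 : ℕ)) d := by
  rw [shortSum, Nat.add_div_right _ two_pos, Finset.sum_range_succ', add_comm, shortSum_two,
    shortSum]
  congr 1
  · simp
  · refine Finset.sum_congr rfl fun i _ => ?_
    rw [add_assoc, add_assoc, ← Nat.cast_add, ← Nat.cast_add]
    congr 4 <;> ring

theorem shortSum_add_two' (α : ZMod n → A) (x : ZMod n) {d : ℕ} (hd : d % 2 = 0) :
    shortSum α x (d + 2) = shortSum α x d + shortSum α (x + d) 2 := by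
  rw [shortSum, Nat.add_div_right _ two_pos, Finset.sum_range_succ, shortSum_two, shortSum]
  have h : 2 * (d / 2) = d := by omega
  rw [h, Nat.cast_add, Nat.cast_add]
  simp [add_assoc]

theorem shortSum_q_sub_one {α : ZMod n → A} (hodd : q % 2 = 1) (hα : IsAlternating q α)
    (x : ZMod n) : shortSum α x (q - 1) = α x := by
  have h := hα x
  rw [show q = 2 * ((q - 1) / 2) + 1 by omega,
    sum_range_two_mul_add_one_alternating (fun i : ℕ => α (x + (i : ℕ)))] at h
  rw [Nat.cast_zero, add_zero, sub_eq_zero] at h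
  exact h.symm

theorem shortSum_q {α : ZMod n → A} (hodd : q % 2 = 1) (hα : IsAlternating q α)
    (x : ZMod n) : shortSum α x q = α x := by
  rw [← shortSum_q_sub_one hodd hα x, shortSum, shortSum, show q / 2 = (q - 1) / 2 by omega]

theorem shortSum_q_add_one {α : ZMod n → A} (hodd : q % 2 = 1) (hα : IsAlternating q α)
    (x : ZMod n) : shortSum α x (q + 1) = α (x + 1) := by
  rw [show q + 1 = q - 1 + 2 by omega, shortSum_add_two' α x (by omega),
    shortSum_q_sub_one hodd hα, shortSum_two]
  have h1 : x + (q - 1 : ℕ) + 1 = x + q := by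
    rw [add_assoc, ← Nat.cast_succ]; congr 2; omega
  have h2 : x + (q - 1 : ℕ) + 2 = x + 1 + q := by
    linear_combination h1
  rw [h1, h2, hα.add_q hodd, hα.add_q hodd]
  abel

theorem val_add_natCast_sub {x : ZMod n} {d : ℕ} (hd : d < n) : (x + d - x).val = d := by
  rw [add_sub_cancel_left, ZMod.val_natCast, Nat.mod_eq_of_lt hd]

theorem val_sub_add_natCast {x : ZMod n} {d : ℕ} (hd0 : 0 < d) (hd : d < n) :
    (x - (x + d)).val = n - d := by
  rw [sub_add_cancel_left, ← Nat.mod_eq_of_lt (show n - d < n by omega), ← ZMod.val_natCast,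
    Nat.cast_sub hd.le, ZMod.natCast_self, zero_sub]

theorem cochain_short [NeZero n] (α : ZMod n → A) (x : ZMod n) {d : ℕ} (hd : d ≤ q + 1) (hn : d < n) :
    cochain q α (x, x + d) = shortSum α x d := by
  simp only [cochain, val_add_natCast_sub hn, if_pos hd]

theorem cochain_long [NeZero n] (α : ZMod n → A) (x : ZMod n) {d : ℕ} (hd : q + 1 < d)
    (hn : d + q + 1 < n) : cochain q α (x, x + d) = 0 := by
  simp only [cochain]
  rw [val_add_natCast_sub (by omega), val_sub_add_natCast (by omega) (by omega), if_neg (by omega),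
    if_neg (by omega)]

@[simp]
theorem cochain_self (α : ZMod n → A) (x : ZMod n) : cochain q α (x, x) = 0 := by
  simp [cochain]

theorem cochain_swap [NeZero n] (hn : 2 * q + 2 < n) (α : ZMod n → A) (u v : ZMod n) :
    cochain q α (v, u) = -cochain q α (u, v) := by
  by_cases huv : u = v
  · subst huv; simp
  obtain ⟨d, hd0, hd, rfl⟩ : ∃ d : ℕ, 0 < d ∧ d < n ∧ v = u + d := by
    refine ⟨(v - u).val, ?_, ZMod.val_lt _, by rw [ZMod.natCast_zmod_val]; ring⟩
    rw [Nat.pos_iff_ne_zero, Ne, ZMod.val_eq_zero, sub_eq_zero]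
    exact fun h => huv h.symm
  simp only [cochain, val_add_natCast_sub hd, val_sub_add_natCast hd0 hd]
  split_ifs with h1 h2
  · omega
  all_goals simp

/-- A skew-symmetric function which is the coboundary of `h₀, h₁, h₂, h₃` on the vertices of a
tetrahedron satisfies the cocycle condition there. -/
theorem cocycle_of_potential {V : Type*} [DecidableEq V] {f : V × V → A} (h0 : ∀ u, f (u, u) = 0)
    (hswap : ∀ u v, f (v, u) = -f (u, v)) {p₀ p₁ p₂ p₃ : V} {h₁ h₂ h₃ : A}
    (h01 : f (p₀, p₁) = h₁) (h02 : f (p₀, p₂) = h₂) (h03 : f (p₀, p₃) = h₃)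
    (h12 : f (p₁, p₂) = h₂ - h₁) (h13 : f (p₁, p₃) = h₃ - h₁) (h23 : f (p₂, p₃) = h₃ - h₂)
    {u v w : V} (h : ({u, v, w} : Finset V) ⊆ {p₀, p₁, p₂, p₃}) :
    f (v, w) - f (u, w) + f (u, v) = 0 := by
  have h10 : f (p₁, p₀) = -h₁ := by rw [hswap, h01]
  have h20 : f (p₂, p₀) = -h₂ := by rw [hswap, h02]
  have h30 : f (p₃, p₀) = -h₃ := by rw [hswap, h03]
  have h21 : f (p₂, p₁) = h₁ - h₂ := by rw [hswap, h12, neg_sub]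
  have h31 : f (p₃, p₁) = h₁ - h₃ := by rw [hswap, h13, neg_sub]
  have h32 : f (p₃, p₂) = h₂ - h₃ := by rw [hswap, h23, neg_sub]
  let R : V → A → Prop := fun x k =>
    (x = p₀ ∧ k = 0) ∨ (x = p₁ ∧ k = h₁) ∨ (x = p₂ ∧ k = h₂) ∨ (x = p₃ ∧ k = h₃)
  have ex : ∀ x ∈ ({u, v, w} : Finset V), ∃ k, R x k := by
    intro x hx
    have := h hx
    simp only [Finset.mem_insert, Finset.mem_singleton] at this
    rcases this with h | h | h | h
    · exact ⟨0, Or.inl ⟨h, rfl⟩⟩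
    · exact ⟨h₁, Or.inr (Or.inl ⟨h, rfl⟩)⟩
    · exact ⟨h₂, Or.inr (Or.inr (Or.inl ⟨h, rfl⟩))⟩
    · exact ⟨h₃, Or.inr (Or.inr (Or.inr ⟨h, rfl⟩))⟩
  have key : ∀ {x y k l}, R x k → R y l → f (x, y) = l - k := by
    rintro x y k l (⟨rfl, rfl⟩ | ⟨rfl, rfl⟩ | ⟨rfl, rfl⟩ | ⟨rfl, rfl⟩)
      (⟨rfl, rfl⟩ | ⟨rfl, rfl⟩ | ⟨rfl, rfl⟩ | ⟨rfl, rfl⟩) <;>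
    (try simp only [h0, sub_self, sub_zero, zero_sub]) <;> assumption
  obtain ⟨k, hk⟩ := ex u (by simp)
  obtain ⟨l, hl⟩ := ex v (by simp)
  obtain ⟨m, hm⟩ := ex w (by simp)
  rw [key hl hm, key hk hm, key hk hl]
  abel

theorem cochain_cocycle [NeZero n] (hn : n = 4 * q + 2 * s) (hq : 3 ≤ q) (hodd : q % 2 = 1)
    (hK : ModelledOn K q s) {α : ZMod n → A} (hα : IsAlternating q α) {u v w : ZMod n}
    (h : ({u, v, w} : Finset (ZMod n)) ∈ K.faces) :
    cochain q α (v, w) - cochain q α (u, w) + cochain q α (u, v) = 0 := by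
  obtain ⟨-, x, a, b, c, hF, hsub⟩ := (hK _).1 h
  have S : ∀ (i j d : ℕ), i + d = j → d ≤ q + 1 →
      cochain q α (x + i, x + j) = shortSum α (x + i) d := by
    rintro i _ d rfl hd
    rw [Nat.cast_add, ← add_assoc, cochain_short _ _ hd (by omega)]
  have L : ∀ (i j d : ℕ), i + d = j → q + 1 < d → d + q + 1 < n →
      cochain q α (x + i, x + j) = 0 := by
    rintro i _ d rfl hd hd'
    rw [Nat.cast_add, ← add_assoc, cochain_long _ _ hd hd']
  have S0 : ∀ d : ℕ, d ≤ q + 1 → cochain q α (x, x + d) = shortSum α x d :=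
    fun d hd => cochain_short _ _ hd (by omega)
  have L0 : ∀ d : ℕ, q + 1 < d → d + q + 1 < n → cochain q α (x, x + d) = 0 :=
    fun d hd hd' => cochain_long _ _ hd hd'
  have F1 := shortSum_q_sub_one hodd hα
  have F2 := shortSum_q hodd hα
  have F3 := shortSum_q_add_one hodd hα
  have E := hα.add_q hodd
  have c1 : ((q + 1 : ℕ) : ZMod n) = 1 + q := by push_cast; ring
  have c2 : ∀ y : ZMod n, y + (q - 1 : ℕ) + 1 = y + q := fun y => by
    rw [Nat.cast_sub (by omega)]; push_cast; ring
  have c3 : ∀ y : ZMod n, y + (q - 1 : ℕ) + 2 = y + 1 + q := fun y => by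
    rw [Nat.cast_sub (by omega)]; push_cast; ring
  have potential := @cocycle_of_potential A _ (ZMod n) _ (cochain q α) (cochain_self α)
    (cochain_swap (by omega) α) x
  rcases hF with ⟨ha, hb, hc⟩ | ⟨ha, hb, hc⟩ | ⟨ha, hb, hc⟩ | ⟨ha, hb, hc⟩ |
    ⟨ha, hc, h1, h2, h3⟩ | ⟨ha, hc, h1, h2⟩
  · rw [ha, hb, hc] at hsub
    refine potential (h₁ := 0) (h₂ := α (x + 1)) (h₃ := 0) ?_ ?_ ?_ ?_ ?_ ?_ hsub
    · rw [S0 _ (by omega), shortSum_one]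
    · rw [S0 _ (by omega), F3]
    · rw [L0 _ (by omega) (by omega)]
    · rw [S _ _ q (by omega) (by omega), F2]; simp
    · rw [L _ _ (2 * q - 1) (by omega) (by omega) (by omega)]; simp
    · rw [S _ _ (q - 1) (by omega) (by omega), F1, c1, ← add_assoc, E]; simp
  · rw [ha, hb, hc] at hsub
    refine potential (h₁ := α x) (h₂ := α x) (h₃ := 0) ?_ ?_ ?_ ?_ ?_ ?_ hsub
    · rw [S0 _ (by omega), F1]
    · rw [S0 _ (by omega), F2]
    · rw [L0 _ (by omega) (by omega)]
    · rw [S _ _ 1 (by omega) (by omega)]; simp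
    · rw [S _ _ (q + 1) (by omega) (by omega), F3, c2, E]; simp
    · rw [S _ _ q (by omega) (by omega), F2, E]; simp
  · rw [ha, hb, hc] at hsub
    refine potential (h₁ := α x) (h₂ := 0) (h₃ := 0) ?_ ?_ ?_ ?_ ?_ ?_ hsub
    · rw [S0 _ (by omega), F2]
    · rw [L0 _ (by omega) (by omega)]
    · rw [L0 _ (by omega) (by omega)]
    · rw [S _ _ (q - 1) (by omega) (by omega), F1, E]; simp
    · rw [S _ _ q (by omega) (by omega), F2, E]; simp
    · rw [S _ _ 1 (by omega) (by omega)]; simp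
  · rw [ha, hb, hc] at hsub
    refine potential (h₁ := α x) (h₂ := α (x + 1)) (h₃ := 0) ?_ ?_ ?_ ?_ ?_ ?_ hsub
    · rw [S0 _ (by omega), F1]
    · rw [S0 _ (by omega), F3]
    · rw [L0 _ (by omega) (by omega)]
    · rw [S _ _ 2 (by omega) (by omega), shortSum_two, c2, c3, E, E]; abel
    · rw [S _ _ (q + 1) (by omega) (by omega), F3, c2, E]; simp
    · rw [S _ _ (q - 1) (by omega) (by omega), F1, c1, ← add_assoc, E]; simp
  · rw [ha, hc] at hsub
    refine potential (S0 _ (by omega)) (S0 _ (by omega)) (S0 _ (by omega)) ?_ ?_ ?_ hsub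
    · obtain ⟨j, rfl⟩ : ∃ j, b = j + 2 := ⟨b - 2, by omega⟩
      rw [S _ _ j (by omega) (by omega), shortSum_add_two]; abel
    · rw [S _ _ b (by omega) (by omega), shortSum_add_two]; abel
    · rw [S _ _ 2 (by omega) (by omega), shortSum_add_two' _ _ h1]; abel
  · rw [ha, hc] at hsub
    refine potential (h₁ := 0) (h₂ := 0) (h₃ := 0) ?_ ?_ ?_ ?_ ?_ ?_ hsub
    · rw [S0 _ (by omega), shortSum_one]
    · rw [L0 _ (by omega) (by omega)]
    · rw [L0 _ (by omega) (by omega)]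
    · rw [L _ _ (b - 1) (by omega) (by omega) (by omega)]; simp
    · rw [L _ _ b (by omega) (by omega) (by omega)]; simp
    · rw [S _ _ 1 (by omega) (by omega)]; simp

end

/-! ### The relations among the edges -/

section

variable {n q s : ℕ} {K : PreAbstractSimplicialComplex (ZMod n)} {B : Type*} [AddCommGroup B]

/-- The value of `e` on the loop which runs along the edge from `x` to `x + d` and returns by
`d` steps of length one. -/
def excess (e : ZMod n → ZMod n → B) (x : ZMod n) (d : ℕ) : B :=
  e x (x + d) - ∑ j ∈ Finset.range d, e (x + (j : ℕ)) (x + (j : ℕ) + 1)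

theorem excess_one (e : ZMod n → ZMod n → B) (x : ZMod n) : excess e x 1 = 0 := by
  simp [excess]

theorem excess_add {e : ZMod n → ZMod n → B} {x : ZMod n} {c d : ℕ}
    (h : e x (x + c + d) = e x (x + c) + e (x + c) (x + c + d)) :
    excess e x (c + d) = excess e x c + excess e (x + c) d := by
  rw [excess, Nat.cast_add, ← add_assoc, h, Finset.sum_range_add, excess, excess]
  have : ∀ j : ℕ, x + ((c + j : ℕ) : ZMod n) = x + c + (j : ℕ) := fun j => by push_cast; ring
  simp only [this]
  abel

theorem self_eq_zero_of_additive (hK : ModelledOn K q s) {e : ZMod n → ZMod n → B}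
    (he : ∀ u v w, ({u, v, w} : Finset (ZMod n)) ∈ K.faces → e u w = e u v + e v w)
    (x : ZMod n) : e x x = 0 := by
  have h := he x x x ((hK _).2 ⟨by simp, x, 1, q + 1, 2 * q, Or.inl ⟨rfl, rfl, rfl⟩, by
    simp [quad]⟩)
  simpa using h

/-- The relations satisfied by the loops `excess e x d`: for `d ≥ 2 q - 1` they are all equal to
some `φ`, and those for `d ≤ q + 1` are expressed by `a x = excess e x q`. The alternating sums of
`q` consecutive `a x` vanish; as two neighbouring sums add up to `a x + a (x + q) = φ`, also `φ`
vanishes. -/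
theorem excess_relations [NeZero n] (hn : n = 4 * q + 2 * s) (hq : 3 ≤ q) (hodd : q % 2 = 1)
    (hK : ModelledOn K q s) {e : ZMod n → ZMod n → B}
    (he : ∀ u v w, ({u, v, w} : Finset (ZMod n)) ∈ K.faces → e u w = e u v + e v w) :
    IsAlternating q (fun x => excess e x q) ∧
    (∀ x, ∀ d : ℕ, d = 1 ∨ d = q ∨ (d % 2 = 0 ∧ d ≤ q + 1) →
      excess e x d = shortSum (fun x => excess e x q) x d) ∧
    ∀ x, ∀ d : ℕ, 2 * q - 1 ≤ d → d ≤ 2 * q + 2 * s + 1 → excess e x d = 0 := by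
  have rel : ∀ {c d : ℕ}, TriangleType q s c d → ∀ x : ZMod n,
      excess e x (c + d) = excess e x c + excess e (x + c) d := fun h x =>
    excess_add (he _ _ _ (h.mem_faces hn hq hodd hK x))
  have hlong : ∀ i : ℕ, i ≤ 2 * s + 2 → ∀ x,
      excess e x (2 * q - 1 + i) = excess e 0 (2 * q - 1) := by
    have h1 : ∀ d, 2 * q - 1 ≤ d → d ≤ 2 * q + 2 * s → ∀ x,
        excess e x (d + 1) = excess e (x + 1) d := by
      intro d h1 h2 x
      have := rel (c := 1) (d := d) (by
        right; right; right; right; right; right; right; right; omega) x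
      rwa [excess_one, zero_add, add_comm 1 d, Nat.cast_one] at this
    have h2 : ∀ d, 2 * q - 1 ≤ d → d ≤ 2 * q + 2 * s → ∀ x,
        excess e x (d + 1) = excess e x d := by
      intro d h1 h2 x
      have hT : CyclicTriangleType n q s d (d + 1) :=
        Or.inr (Or.inl (by
        right; right; right; right; right; right; right; right; omega))
      have h := hT.mem_faces hn hq hodd hK (by omega) (by omega) x
      rw [Nat.cast_succ, ← add_assoc, ← Nat.cast_one (R := ZMod n)] at h
      rw [excess_add (he _ _ _ h), excess_one, add_zero]
    have h3 : ∀ x, excess e x (2 * q - 1) = excess e 0 (2 * q - 1) := by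
      have h : ∀ m : ℕ, excess e (m : ZMod n) (2 * q - 1) = excess e 0 (2 * q - 1) := by
        intro m
        induction m with
        | zero => simp
        | succ m ih =>
          rw [Nat.cast_succ, ← h1 _ le_rfl (by omega), h2 _ le_rfl (by omega), ih]
      intro x
      have := h x.val
      rwa [ZMod.natCast_zmod_val] at this
    intro i
    induction i with
    | zero => exact fun _ x => h3 x
    | succ i ih =>
      intro hi x
      rw [← add_assoc, h2 _ (by omega) (by omega), ih (by omega)]
  have hlong' : ∀ x, ∀ d : ℕ, 2 * q - 1 ≤ d → d ≤ 2 * q + 2 * s + 1 →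
      excess e x d = excess e 0 (2 * q - 1) := by
    intro x d h1 h2
    have := hlong (d - (2 * q - 1)) (by omega) x
    rwa [Nat.add_sub_cancel' h1] at this
  set φ := excess e 0 (2 * q - 1)
  set a : ZMod n → B := fun x => excess e x q with ha
  have hsub : ∀ x, excess e x (q - 1) = a x := by
    intro x
    have := rel (c := q - 1) (d := 1) (by right; right; right; left; omega) x
    rw [excess_one, add_zero, Nat.sub_add_cancel (by omega)] at this
    exact this.symm
  have hadd : ∀ x, excess e x (q + 1) = a (x + 1) := by
    intro x
    have := rel (c := 1) (d := q) (by right; right; left; omega) x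
    rwa [excess_one, zero_add, add_comm 1 q, Nat.cast_one] at this
  have hφ : ∀ x, a x + a (x + q) = φ := by
    intro x
    have := rel (c := q) (d := q) (by
        right; right; right; right; right; left; omega) x
    rw [hlong' _ _ (by omega) (by omega)] at this
    exact this.symm
  have htwo : ∀ x, excess e x 2 = a (x + 1) - a (x + 2) := by
    intro x
    have h := rel (c := q - 1) (d := 2) (by
        right; right; right; right; right; right; right; left; omega) (x - (q - 1 : ℕ))
    rw [show q - 1 + 2 = q + 1 by omega, hsub, hadd, sub_add_cancel] at h
    have h1 := hφ (x - (q - 1 : ℕ))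
    have h2 := hφ (x - (q - 1 : ℕ) + 1)
    have e1 : x - (q - 1 : ℕ) + q = x + 1 := by
      rw [Nat.cast_sub (by omega)]; push_cast; ring
    have e2 : x - (q - 1 : ℕ) + 1 + q = x + 2 := by
      rw [Nat.cast_sub (by omega)]; push_cast; ring
    rw [e1] at h1
    rw [e2] at h2
    rw [eq_sub_of_add_eq h1, eq_sub_of_add_eq h2] at h
    rw [eq_sub_of_add_eq' h.symm]
    abel
  have heven : ∀ j : ℕ, 2 * j ≤ q + 1 → 0 < j → ∀ x, excess e x (2 * j) = shortSum a x (2 * j) := by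
    intro j
    induction j with
    | zero => intro _ h; omega
    | succ j ih =>
      intro hj _ x
      rcases Nat.eq_zero_or_pos j with rfl | hj0
      · rw [zero_add, mul_one, htwo, shortSum_two]
      · have := rel (c := 2) (d := 2 * j) (by
        right; right; right; right; right; right; left; omega) x
        rw [mul_add, mul_one, shortSum_add_two, ← ih (by omega) hj0, shortSum_two, ← htwo, add_comm,
          this]
  have halt : IsAlternating q a := by
    intro x
    have h := sum_range_two_mul_add_one_alternating (fun i : ℕ => a (x + (i : ℕ))) ((q - 1) / 2)
    rw [show 2 * ((q - 1) / 2) + 1 = q by omega] at h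
    rw [h]
    have h1 := heven ((q - 1) / 2) (by omega) (by omega) x
    rw [show 2 * ((q - 1) / 2) = q - 1 by omega, hsub] at h1
    rw [Nat.cast_zero, add_zero, h1, shortSum, sub_self]
  have hφ0 : φ = 0 := by
    rw [← hφ 0, halt.add_q hodd, add_neg_cancel]
  refine ⟨halt, ?_, fun x d h1 h2 => by rw [hlong' x d h1 h2, hφ0]⟩
  rintro x d (rfl | rfl | ⟨h1, h2⟩)
  · rw [excess_one, shortSum_one]
  · exact (shortSum_q hodd halt x).symm
  · rcases Nat.eq_zero_or_pos d with rfl | hd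
    · simp [excess, self_eq_zero_of_additive hK he]
    · obtain ⟨j, rfl⟩ : ∃ j, d = 2 * j := ⟨d / 2, by omega⟩
      exact heven j h2 (by omega) x

/-- The sum of the values of `e` on the edges `(0, 1), …, (x - 1, x)`. -/
def stepPotential (e : ZMod n → ZMod n → B) (x : ZMod n) : B :=
  ∑ j ∈ Finset.range x.val, e (j : ℕ) ((j : ℕ) + 1)

/-- The differences of the edges of the complex. -/
theorem exists_offset_of_mem_faces (hn : n = 4 * q + 2 * s) (hq : 3 ≤ q) (hodd : q % 2 = 1)
    (hK : ModelledOn K q s) {u v : ZMod n} (h : ({u, v} : Finset (ZMod n)) ∈ K.faces) :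
    ∃ d : ℕ, (v = u + d ∨ u = v + d) ∧
      ((d = 1 ∨ d = q ∨ (d % 2 = 0 ∧ d ≤ q + 1)) ∨ (2 * q - 1 ≤ d ∧ d ≤ 2 * q + s + 1)) := by
  obtain ⟨-, x, a, b, c, hF, hsub⟩ := (hK _).1 h
  obtain ⟨⟨h0, h1, h2, h3⟩, -⟩ := hF.cyclicTriangleType hn hq hodd
  have key : ∀ i j : ℕ, i ≤ j → ((j - i = 1 ∨ j - i = q ∨ ((j - i) % 2 = 0 ∧ j - i ≤ q + 1)) ∨
        (2 * q - 1 ≤ j - i ∧ j - i ≤ 2 * q + s + 1)) →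
      (u = x + i ∧ v = x + j) ∨ (u = x + j ∧ v = x + i) →
      ∃ d : ℕ, (v = u + d ∨ u = v + d) ∧
        ((d = 1 ∨ d = q ∨ (d % 2 = 0 ∧ d ≤ q + 1)) ∨ (2 * q - 1 ≤ d ∧ d ≤ 2 * q + s + 1)) := by
    intro i j hij hd huv
    have e : x + (j : ZMod n) = x + i + (j - i : ℕ) := by
      rw [add_assoc, ← Nat.cast_add]; congr 2; omega
    refine ⟨j - i, ?_, hd⟩
    rcases huv with ⟨rfl, rfl⟩ | ⟨rfl, rfl⟩
    · exact Or.inl e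
    · exact Or.inr e
  have mem : ∀ y ∈ ({u, v} : Finset (ZMod n)), y = x + (0 : ℕ) ∨ y = x + a ∨ y = x + b ∨
      y = x + c := by
    intro y hy
    simpa [quad] using hsub hy
  unfold FacetType at hF
  rcases mem u (by simp) with hu | hu | hu | hu <;> rcases mem v (by simp) with hv | hv | hv | hv
  · exact key 0 0 (by omega) (by omega) (Or.inl ⟨hu, hv⟩)
  · exact key 0 a (by omega) (by omega) (Or.inl ⟨hu, hv⟩)
  · exact key 0 b (by omega) (by omega) (Or.inl ⟨hu, hv⟩)
  · exact key 0 c (by omega) (by omega) (Or.inl ⟨hu, hv⟩)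
  · exact key 0 a (by omega) (by omega) (Or.inr ⟨hu, hv⟩)
  · exact key a a (by omega) (by omega) (Or.inl ⟨hu, hv⟩)
  · exact key a b (by omega) (by omega) (Or.inl ⟨hu, hv⟩)
  · exact key a c (by omega) (by omega) (Or.inl ⟨hu, hv⟩)
  · exact key 0 b (by omega) (by omega) (Or.inr ⟨hu, hv⟩)
  · exact key a b (by omega) (by omega) (Or.inr ⟨hu, hv⟩)
  · exact key b b (by omega) (by omega) (Or.inl ⟨hu, hv⟩)
  · exact key b c (by omega) (by omega) (Or.inl ⟨hu, hv⟩)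
  · exact key 0 c (by omega) (by omega) (Or.inr ⟨hu, hv⟩)
  · exact key a c (by omega) (by omega) (Or.inr ⟨hu, hv⟩)
  · exact key b c (by omega) (by omega) (Or.inr ⟨hu, hv⟩)
  · exact key c c (by omega) (by omega) (Or.inl ⟨hu, hv⟩)

/-- Modulo coboundaries, every `1`-cocycle on the complex is the cochain of an alternating
sequence. -/
theorem eq_cochain_add_stepPotential [NeZero n] (hn : n = 4 * q + 2 * s) (hq : 3 ≤ q)
    (hodd : q % 2 = 1) (hK : ModelledOn K q s) {e : ZMod n → ZMod n → B}
    (he : ∀ u v w, ({u, v, w} : Finset (ZMod n)) ∈ K.faces → e u w = e u v + e v w)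
    {u v : ZMod n} (huv : ({u, v} : Finset (ZMod n)) ∈ K.faces) :
    e u v = cochain q (fun x => excess e x q) (u, v) + (stepPotential e v - stepPotential e u) := by
  obtain ⟨halt, hshort, hlong⟩ := excess_relations hn hq hodd hK he
  have hself := self_eq_zero_of_additive hK he
  -- the closed path `0, 1, …, n - 1, 0` is twice an edge of length at least `2 q - 1`
  have htotal : ∑ j ∈ Finset.range n, e (j : ℕ) ((j : ℕ) + 1) = 0 := by
    have h1 := hlong 0 (2 * q) (by omega) (by omega)
    have h2 := hlong (2 * q : ℕ) (2 * q + 2 * s) (by omega) (by omega)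
    have hface : ({0, ((2 * q : ℕ) : ZMod n), 0} : Finset (ZMod n)) ∈ K.faces :=
      (hK _).2 ⟨by simp, 0, 1, q + 1, 2 * q, Or.inl ⟨rfl, rfl, rfl⟩, by
        simp [quad, Finset.insert_subset_iff]⟩
    have h3 := he _ _ _ hface
    have h4 : ((2 * q : ℕ) : ZMod n) + (2 * q + 2 * s : ℕ) = 0 := by
      rw [← Nat.cast_add, natCast_eq_of_eq_add_self (b := 0) (by omega), Nat.cast_zero]
    rw [excess, sub_eq_zero, zero_add] at h1
    rw [excess, sub_eq_zero, h4] at h2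
    rw [hself, h1, h2] at h3
    have hr : Finset.range n = Finset.range (2 * q + (2 * q + 2 * s)) := by congr 1; omega
    rw [hr, Finset.sum_range_add, h3]
    congr 1
    · exact Finset.sum_congr rfl fun j _ => by simp
    · exact Finset.sum_congr rfl fun j _ => by rw [Nat.cast_add]
  have hstep : ∀ x : ZMod n, e x (x + 1) = stepPotential e (x + 1) - stepPotential e x := by
    intro x
    have hx := ZMod.val_lt x
    have hsum : stepPotential e x + e x (x + 1) =
        ∑ j ∈ Finset.range (x.val + 1), e (j : ℕ) ((j : ℕ) + 1) := by
      rw [Finset.sum_range_succ, stepPotential, ZMod.natCast_zmod_val]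
    rw [eq_sub_iff_add_eq', hsum, stepPotential]
    have h1 : (1 : ZMod n).val = 1 := by
      rw [← Nat.cast_one, ZMod.val_natCast, Nat.mod_eq_of_lt (by omega)]
    by_cases hlt : x.val + 1 < n
    · rw [ZMod.val_add_of_lt (by rwa [h1]), h1]
    · have hx1 : x + 1 = 0 := by
        rw [← ZMod.natCast_zmod_val x, ← Nat.cast_succ,
          natCast_eq_of_eq_add_self (b := 0) (by omega), Nat.cast_zero]
      rw [hx1, ZMod.val_zero, show x.val + 1 = n by omega, htotal, Finset.sum_range_zero]
  have hsteps : ∀ (x : ZMod n) (d : ℕ), ∑ j ∈ Finset.range d, e (x + (j : ℕ)) (x + (j : ℕ) + 1) =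
      stepPotential e (x + d) - stepPotential e x := by
    intro x d
    have := Finset.sum_range_sub (fun j : ℕ => stepPotential e (x + (j : ℕ))) d
    rw [Nat.cast_zero, add_zero] at this
    rw [← this]
    exact Finset.sum_congr rfl fun j _ => by rw [hstep, Nat.cast_succ, add_assoc]
  have hedge : ∀ (x : ZMod n) (d : ℕ),
      ((d = 1 ∨ d = q ∨ (d % 2 = 0 ∧ d ≤ q + 1)) ∨ (2 * q - 1 ≤ d ∧ d ≤ 2 * q + s + 1)) →
      e x (x + d) = cochain q (fun x => excess e x q) (x, x + d) +
        (stepPotential e (x + d) - stepPotential e x) := by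
    intro x d hd
    rw [← hsteps, ← sub_eq_iff_eq_add]
    change excess e x d = _
    rcases hd with hd | ⟨h1, h2⟩
    · rw [hshort x d hd, cochain_short _ _ (by omega) (by omega)]
    · rw [hlong x d h1 (by omega), cochain_long _ _ (by omega) (by omega)]
  obtain ⟨d, h | h, hd⟩ := exists_offset_of_mem_faces hn hq hodd hK huv
  · rw [h]; exact hedge u d hd
  · have hface : ({u, v, u} : Finset (ZMod n)) ∈ K.faces := by
      have : ({u, v, u} : Finset (ZMod n)) = {u, v} := by ext; simp; tauto
      rwa [this]
    have h1 := he _ _ _ hface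
    have h2 := hedge v d hd
    rw [← h] at h2
    rw [hself, h2] at h1
    rw [cochain_swap (by omega) _ v u, eq_neg_of_add_eq_zero_left h1.symm]
    abel

end

/-! ### The first homology group -/

section

variable {n q s : ℕ} {K : PreAbstractSimplicialComplex (ZMod n)}

theorem companionOrbit_val_natCast (hq : 3 ≤ q) (hodd : q % 2 = 1) (hdvd : 2 * q ∣ n) (m : ℕ) :
    companionOrbit q (m : ZMod n).val = companionOrbit q m := by
  obtain ⟨j, hj⟩ := hdvd
  have h : companionMatrix q ^ n = 1 := by
    rw [hj, pow_mul, companionMatrix_pow_two_mul hq hodd, one_pow]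
  rw [companionOrbit, companionOrbit, ZMod.val_natCast, ← pow_eq_pow_mod m h]

theorem companionOrbit_val_add [NeZero n] (hq : 3 ≤ q) (hodd : q % 2 = 1) (hdvd : 2 * q ∣ n)
    (x : ZMod n) (m : ℕ) : companionOrbit q (x + m).val = companionOrbit q (x.val + m) := by
  rw [← companionOrbit_val_natCast hq hodd hdvd (x.val + m), Nat.cast_add,
    ZMod.natCast_zmod_val]

theorem isAlternating_companionOrbit [NeZero n] (hq : 3 ≤ q) (hodd : q % 2 = 1)
    (hdvd : 2 * q ∣ n) : IsAlternating q fun x : ZMod n => companionOrbit q x.val := by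
  intro x
  simp only [companionOrbit_val_add hq hodd hdvd]
  exact companionOrbit_alternating_sum hq hodd _

theorem map_cochain {A B : Type*} [AddCommGroup A] [AddCommGroup B] (f : A →+ B)
    (α : ZMod n → A) (e : ZMod n × ZMod n) :
    f (cochain q α e) = cochain q (fun x => f (α x)) e := by
  unfold cochain shortSum
  split_ifs <;> simp

theorem cochain_add_one {A : Type*} [AddCommGroup A] (α : ZMod n → A) (u v : ZMod n) :
    cochain q α (u + 1, v + 1) = cochain q (fun x => α (x + 1)) (u, v) := by
  simp only [cochain, shortSum, add_sub_add_right_eq_sub, add_right_comm]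

/-- The cocycle with values in `ℤ^(q - 1)` given by the orbit of the companion matrix, as a linear
map on `1`-chains. -/
noncomputable def companionCochain (n q : ℕ) :
    (ZMod n × ZMod n →₀ ℤ) →ₗ[ℤ] (Fin (q - 1) → ℤ) :=
  Finsupp.linearCombination ℤ (cochain q fun x : ZMod n => companionOrbit q x.val)

theorem companionCochain_single (e : ZMod n × ZMod n) :
    companionCochain n q (Finsupp.single e 1) =
      cochain q (fun x : ZMod n => companionOrbit q x.val) e := by
  rw [companionCochain, Finsupp.linearCombination_single, one_smul]

theorem companionCochain_eq_zero_of_mem_boundariesOne [NeZero n] (hn : n = 4 * q + 2 * s)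
    (hq : 3 ≤ q) (hodd : q % 2 = 1) (hdvd : 2 * q ∣ n) (hK : ModelledOn K q s)
    {c : ZMod n × ZMod n →₀ ℤ} (hc : c ∈ K.boundariesOne) : companionCochain n q c = 0 := by
  suffices H : K.boundariesOne ≤ LinearMap.ker (companionCochain n q) from H hc
  rw [PreAbstractSimplicialComplex.boundariesOne, PreAbstractSimplicialComplex.chainsTwo,
    Finsupp.supported_eq_span_single, Submodule.map_span, Submodule.span_le]
  rintro _ ⟨_, ⟨⟨u, v, w⟩, ht, rfl⟩, rfl⟩
  rw [SetLike.mem_coe, LinearMap.mem_ker, PreAbstractSimplicialComplex.boundaryTwo,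
    Finsupp.linearCombination_single, one_smul, map_add, map_sub]
  simp only [companionCochain_single]
  exact cochain_cocycle hn hq hodd hK (isAlternating_companionOrbit hq hodd hdvd) ht

theorem companionCochain_chainMap [NeZero n] (hq : 3 ≤ q) (hodd : q % 2 = 1) (hdvd : 2 * q ∣ n)
    (c : ZMod n × ZMod n →₀ ℤ) :
    companionCochain n q (PreAbstractSimplicialComplex.chainMap (Equiv.addRight 1) c) =
      (companionMatrix q).mulVec (companionCochain n q c) := by
  suffices H : companionCochain n q ∘ₗ PreAbstractSimplicialComplex.chainMap (Equiv.addRight 1) =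
      (companionMatrix q).mulVecLin ∘ₗ companionCochain n q from LinearMap.congr_fun H c
  ext ⟨u, v⟩ : 2
  simp only [LinearMap.comp_apply, Finsupp.lsingle_apply, PreAbstractSimplicialComplex.chainMap,
    Finsupp.lmapDomain_apply, Finsupp.mapDomain_single, companionCochain_single, Prod.map_apply,
    Equiv.coe_addRight, cochain_add_one, Matrix.mulVecLin_apply]
  refine Eq.trans ?_ (map_cochain (companionMatrix q).mulVecLin.toAddMonoidHom _ _).symm
  congr 1
  funext x
  have h := companionOrbit_val_add hq hodd hdvd x 1
  rw [Nat.cast_one] at h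
  rw [h, add_comm, companionOrbit_add, pow_one]
  rfl

/-- The class of an edge modulo boundaries. -/
noncomputable def edgeClass (K : PreAbstractSimplicialComplex (ZMod n)) (u v : ZMod n) :
    (ZMod n × ZMod n →₀ ℤ) ⧸ K.boundariesOne :=
  K.boundariesOne.mkQ (Finsupp.single (u, v) 1)

theorem edgeClass_add (u v w : ZMod n) (h : ({u, v, w} : Finset (ZMod n)) ∈ K.faces) :
    edgeClass K u w = edgeClass K u v + edgeClass K v w := by
  have hb : Finsupp.single (v, w) 1 - Finsupp.single (u, w) 1 + Finsupp.single (u, v) 1 ∈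
      K.boundariesOne := by
    refine ⟨Finsupp.single (u, v, w) 1, Finsupp.single_mem_supported ℤ 1 h, ?_⟩
    rw [PreAbstractSimplicialComplex.boundaryTwo, Finsupp.linearCombination_single, one_smul]
  have h0 := (Submodule.Quotient.mk_eq_zero K.boundariesOne).2 hb
  rw [← Submodule.mkQ_apply, map_add, map_sub] at h0
  change edgeClass K v w - edgeClass K u w + edgeClass K u v = 0 at h0
  rw [← sub_eq_zero, ← neg_eq_zero, ← h0]
  abel

/-- The orbit of the companion matrix is the universal alternating sequence. -/
theorem exists_linearMap_companionOrbit [NeZero n] (hq : 3 ≤ q) (hodd : q % 2 = 1)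
    {B : Type*} [AddCommGroup B] {a : ZMod n → B} (ha : IsAlternating q a) :
    ∃ ψ : (Fin (q - 1) → ℤ) →ₗ[ℤ] B, ∀ x : ZMod n, ψ (companionOrbit q x.val) = a x := by
  let ψ : (Fin (q - 1) → ℤ) →ₗ[ℤ] B := Fintype.linearCombination ℤ fun i => a (i : ℕ)
  have hψ : ∀ j : Fin (q - 1), ψ (unitVec q j) = a (j : ℕ) := by
    intro j
    rw [unitVec_eq_single]
    simp [ψ]
  have key : ∀ x : ℕ, ψ (companionOrbit q x) = a x := by
    intro x
    induction x using Nat.strong_induction_on with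
    | _ x ih =>
      by_cases hx : x < q - 1
      · rw [companionOrbit_of_lt hx]
        exact hψ ⟨x, hx⟩
      · obtain ⟨y, rfl⟩ : ∃ y, x = y + (q - 1) := ⟨x - (q - 1), by omega⟩
        have hr : Finset.range q = Finset.range (q - 1 + 1) := by congr 1; omega
        have hev : (-1 : ℤ) ^ (q - 1) = 1 := Even.neg_one_pow (Nat.even_iff.2 (by omega))
        have h1 := congrArg ψ (companionOrbit_alternating_sum hq hodd y)
        have h2 := ha y
        simp only [map_sum, map_zsmul, map_zero] at h1
        rw [hr, Finset.sum_range_succ, hev, one_smul] at h1 h2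
        rw [eq_neg_of_add_eq_zero_right h1, Nat.cast_add, eq_neg_of_add_eq_zero_right h2]
        congr 1
        refine Finset.sum_congr rfl fun i hi => ?_
        have := Finset.mem_range.1 hi
        rw [ih (y + i) (by omega), Nat.cast_add]
  exact ⟨ψ, fun x => by rw [key, ZMod.natCast_zmod_val]⟩

theorem mem_boundariesOne_of_companionCochain_eq_zero [NeZero n] (hn : n = 4 * q + 2 * s)
    (hq : 3 ≤ q) (hodd : q % 2 = 1) (hK : ModelledOn K q s)
    {c : ZMod n × ZMod n →₀ ℤ} (hc : c ∈ K.cyclesOne) (h0 : companionCochain n q c = 0) :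
    c ∈ K.boundariesOne := by
  have he := edgeClass_add (K := K)
  obtain ⟨halt, -⟩ := excess_relations hn hq hodd hK he
  obtain ⟨ψ, hψ⟩ := exists_linearMap_companionOrbit hq hodd halt
  -- modulo boundaries, every chain is determined by its cochain value and its boundary
  let M : (ZMod n × ZMod n →₀ ℤ) →ₗ[ℤ] (ZMod n × ZMod n →₀ ℤ) ⧸ K.boundariesOne :=
    ψ ∘ₗ companionCochain n q +
      Finsupp.linearCombination ℤ (stepPotential (edgeClass K)) ∘ₗ
        PreAbstractSimplicialComplex.boundaryOne (ZMod n)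
  have hM : K.chainsOne ≤ LinearMap.eqLocus K.boundariesOne.mkQ M := by
    rw [PreAbstractSimplicialComplex.chainsOne, Finsupp.supported_eq_span_single,
      Submodule.span_le]
    rintro _ ⟨⟨u, v⟩, huv, rfl⟩
    change edgeClass K u v = M _
    rw [eq_cochain_add_stepPotential hn hq hodd hK he huv]
    simp only [M, LinearMap.add_apply, LinearMap.comp_apply, companionCochain_single,
      PreAbstractSimplicialComplex.boundaryOne, Finsupp.linearCombination_single, one_smul,
      map_sub]
    congr 1
    refine Eq.trans ?_ (map_cochain ψ.toAddMonoidHom _ _).symm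
    congr 1
    funext x
    exact (hψ x).symm
  have h1 := hM hc.1
  rw [LinearMap.mem_eqLocus] at h1
  have h2 : PreAbstractSimplicialComplex.boundaryOne (ZMod n) c = 0 := hc.2
  rw [← Submodule.Quotient.mk_eq_zero, ← Submodule.mkQ_apply, h1]
  simp [M, h0, h2]

/-- The closed path along the edge from `x` to `x + q` and back by steps of length one. -/
noncomputable def shortLoop (q : ℕ) (x : ZMod n) : ZMod n × ZMod n →₀ ℤ :=
  Finsupp.single (x, x + q) 1 -
    ∑ j ∈ Finset.range q, Finsupp.single (x + (j : ℕ), x + (j + 1 : ℕ)) 1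

theorem shortLoop_mem_cyclesOne (hK : ModelledOn K q s) (x : ZMod n) :
    shortLoop q x ∈ K.cyclesOne := by
  have hq : ({x, x + q} : Finset (ZMod n)) ∈ K.faces :=
    (hK _).2 ⟨by simp, x, q, 2 * q - 1, 2 * q, Or.inr (Or.inr (Or.inl ⟨rfl, rfl, rfl⟩)), by
      simp [quad, Finset.insert_subset_iff]⟩
  have h1 : ∀ y : ZMod n, ({y, y + 1} : Finset (ZMod n)) ∈ K.faces := fun y =>
    (hK _).2 ⟨by simp, y, 1, q + 1, 2 * q, Or.inl ⟨rfl, rfl, rfl⟩, by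
      simp [quad, Finset.insert_subset_iff]⟩
  refine ⟨sub_mem (Finsupp.single_mem_supported ℤ 1 hq) (sum_mem fun j _ =>
    Finsupp.single_mem_supported ℤ 1 ?_), ?_⟩
  · have := h1 (x + (j : ℕ))
    rw [add_assoc, ← Nat.cast_succ] at this
    exact this
  · rw [SetLike.mem_coe, LinearMap.mem_ker, shortLoop, map_sub, map_sum]
    simp only [PreAbstractSimplicialComplex.boundaryOne, Finsupp.linearCombination_single,
      one_smul]
    rw [Finset.sum_range_sub (fun j : ℕ => Finsupp.single (x + (j : ZMod n)) (1 : ℤ)), Nat.cast_zero,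
      add_zero, sub_self]

theorem companionCochain_shortLoop [NeZero n] (hn : n = 4 * q + 2 * s) (hq : 3 ≤ q)
    (hodd : q % 2 = 1) (hdvd : 2 * q ∣ n) (x : ZMod n) :
    companionCochain n q (shortLoop q x) = companionOrbit q x.val := by
  have h1 : ∀ j : ℕ, cochain q (fun x : ZMod n => companionOrbit q x.val)
      (x + (j : ℕ), x + (j + 1 : ℕ)) = 0 := by
    intro j
    rw [Nat.cast_add, ← add_assoc, cochain_short _ _ (by omega) (by omega), shortSum_one]
  rw [shortLoop, map_sub, map_sum]
  simp only [companionCochain_single, h1, Finset.sum_const_zero, sub_zero]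
  rw [cochain_short _ _ (by omega) (by omega),
    shortSum_q hodd (isAlternating_companionOrbit hq hodd hdvd)]

/-- The first homology group is `ℤ^(q - 1)`, with the rotation acting by the companion matrix. -/
theorem exists_homologyEquiv [NeZero n] (hn : n = 4 * q + 2 * s) (hq : 3 ≤ q)
    (hodd : q % 2 = 1) (hdvd : 2 * q ∣ n) (hK : ModelledOn K q s) :
    ∃ Φ : K.HOne ≃ₗ[ℤ] (Fin (q - 1) → ℤ), ∀ g : K.autGroup,
      (g : Equiv.Perm (ZMod n)) = Equiv.addRight 1 →
      ∀ x, Φ (K.homologyAction g x) = (companionMatrix q).mulVec (Φ x) := by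
  let Φ : K.HOne →ₗ[ℤ] (Fin (q - 1) → ℤ) :=
    Submodule.liftQ _ (companionCochain n q ∘ₗ K.cyclesOne.subtype) fun c hc =>
      companionCochain_eq_zero_of_mem_boundariesOne hn hq hodd hdvd hK hc
  have hΦ : ∀ c : K.cyclesOne, Φ (Submodule.Quotient.mk c) = companionCochain n q c :=
    fun c => rfl
  have hinj : Function.Injective Φ := by
    rw [← LinearMap.ker_eq_bot, LinearMap.ker_eq_bot']
    intro x hx
    obtain ⟨c, rfl⟩ := Submodule.Quotient.mk_surjective _ x
    rw [hΦ] at hx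
    exact (Submodule.Quotient.mk_eq_zero _).2
      (mem_boundariesOne_of_companionCochain_eq_zero hn hq hodd hK c.2 hx)
  have hsurj : Function.Surjective Φ := by
    rw [← LinearMap.range_eq_top, ← top_le_iff]
    intro f _
    rw [pi_eq_sum_univ f]
    refine sum_mem fun i _ => Submodule.smul_mem _ _ ?_
    refine ⟨Submodule.Quotient.mk ⟨shortLoop q (i : ℕ), shortLoop_mem_cyclesOne hK _⟩, ?_⟩
    rw [hΦ, companionCochain_shortLoop hn hq hodd hdvd, companionOrbit_val_natCast hq hodd hdvd,
      companionOrbit_of_lt i.2]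
    ext j
    simp [unitVec, Fin.ext_iff, eq_comm]
  refine ⟨LinearEquiv.ofBijective Φ ⟨hinj, hsurj⟩, fun g hg x => ?_⟩
  obtain ⟨c, rfl⟩ := Submodule.Quotient.mk_surjective _ x
  change companionCochain n q
    (PreAbstractSimplicialComplex.chainMap (g : Equiv.Perm (ZMod n)) (c : ZMod n × ZMod n →₀ ℤ)) = _
  rw [hg, companionCochain_chainMap hq hodd hdvd]
  rfl

end

/-! ### The representation of the rotation group -/

section

variable {n q s : ℕ} {K : PreAbstractSimplicialComplex (ZMod n)}

/-- The automorphism group is the group of rotations: `c` corresponds to `v ↦ v + c`. -/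
noncomputable def rotationEquiv [NeZero n] (hn : n = 4 * q + 2 * s) (hq : 3 ≤ q)
    (hodd : q % 2 = 1) (hK : ModelledOn K q s) : Multiplicative (ZMod n) ≃* K.autGroup :=
  MulEquiv.ofBijective
    ({ toFun := fun c => ⟨Equiv.addRight c.toAdd, addRight_mem_autGroup hK _⟩
       map_one' := by ext x; simp
       map_mul' := fun a b => by
        ext x
        simp [add_assoc, add_comm b.toAdd] } : Multiplicative (ZMod n) →* K.autGroup)
    ⟨fun a b h => by
      have h1 := congrArg (fun σ : K.autGroup => (σ : Equiv.Perm (ZMod n)) 0) h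
      simpa using h1,
    fun σ => by
      obtain ⟨c, hc⟩ := exists_eq_addRight_of_mem_autGroup hn hq hodd hK σ.2
      exact ⟨Multiplicative.ofAdd c, Subtype.ext hc.symm⟩⟩

end

theorem theorem4 (q k : ℕ) (hq : q.Prime) (hq2 : 2 < q) :
    ∃ (e : Multiplicative (ZMod (2 * q * (k + 2))) ≃* (mComplex 2 q (2 * k * q)).autGroup)
      (b : Module.Basis (Fin (q - 1)) ℤ (mComplex 2 q (2 * k * q)).HOne)
      (ρ : (mComplex 2 q (2 * k * q)).autGroup →* Matrix.SpecialLinearGroup (Fin (q - 1)) ℤ),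
      ((e (Multiplicative.ofAdd 1) : Equiv.Perm (ZMod (2 * 2 * q + 2 * k * q)))
        = Equiv.addRight 1) ∧
      (∀ g : (mComplex 2 q (2 * k * q)).autGroup,
        (ρ g : Matrix (Fin (q - 1)) (Fin (q - 1)) ℤ)
          = LinearMap.toMatrix b b ((mComplex 2 q (2 * k * q)).homologyAction g)) ∧
      (∀ j : ℕ, (ρ (e (Multiplicative.ofAdd (j : ZMod (2 * q * (k + 2)))))
          : Matrix (Fin (q - 1)) (Fin (q - 1)) ℤ) = companionMatrix q ^ j) ∧
      Nat.card ρ.range = 2 * q := by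
  have hq3 : 3 ≤ q := hq2
  have hodd : q % 2 = 1 := Nat.odd_iff.1 (hq.odd_of_ne_two (by omega))
  have hn : 2 * 2 * q + 2 * k * q = 4 * q + 2 * (k * q) := by ring
  have hN : 2 * q * (k + 2) = 2 * 2 * q + 2 * k * q := by ring
  have : NeZero (2 * 2 * q + 2 * k * q) := ⟨by omega⟩
  have hK := modelledOn_mComplex k hq3 hodd
  set K := mComplex 2 q (2 * k * q)
  let e : Multiplicative (ZMod (2 * q * (k + 2))) ≃* K.autGroup :=
    (AddEquiv.toMultiplicative (ZMod.ringEquivCongr hN).toAddEquiv).trans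
      (rotationEquiv hn hq3 hodd hK)
  have he : (e (Multiplicative.ofAdd 1) : Equiv.Perm (ZMod (2 * 2 * q + 2 * k * q))) =
      Equiv.addRight 1 := by
    change Equiv.addRight (ZMod.ringEquivCongr hN 1) = _
    rw [map_one]
  obtain ⟨Φ, hΦ⟩ := exists_homologyEquiv hn hq3 hodd ⟨k + 2, hN.symm⟩ hK
  let b : Module.Basis (Fin (q - 1)) ℤ K.HOne := Module.Basis.ofEquivFun Φ
  set r : K.autGroup := e (Multiplicative.ofAdd 1) with hr
  have hmat : LinearMap.toMatrix b b (K.homologyAction r) = companionMatrix q := by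
    ext i j
    rw [LinearMap.toMatrix_apply]
    change Φ (K.homologyAction r (b j)) i = _
    rw [hΦ r he, Module.Basis.coe_ofEquivFun, LinearEquiv.apply_symm_apply,
      Matrix.mulVec_single_one]
    rfl
  have hgen : ∀ g : K.autGroup, ∃ j : ℕ, g = r ^ j := by
    intro g
    have : NeZero (2 * q * (k + 2)) := ⟨by omega⟩
    refine ⟨(e.symm g).toAdd.val, ?_⟩
    rw [hr, ← map_pow, ← ofAdd_nsmul, nsmul_one, ZMod.natCast_zmod_val, ofAdd_toAdd,
      MulEquiv.apply_symm_apply]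
  have hpow : ∀ j : ℕ, LinearMap.toMatrix b b (K.homologyAction (r ^ j)) =
      companionMatrix q ^ j := by
    intro j
    rw [map_pow, ← LinearMap.toMatrix_pow, hmat]
  have hdet : ∀ g : K.autGroup, (LinearMap.toMatrix b b (K.homologyAction g)).det = 1 := by
    intro g
    obtain ⟨j, rfl⟩ := hgen g
    rw [hpow, Matrix.det_pow, det_companionMatrix hq3 hodd, one_pow]
  let ρ : K.autGroup →* Matrix.SpecialLinearGroup (Fin (q - 1)) ℤ :=
    { toFun := fun g => ⟨LinearMap.toMatrix b b (K.homologyAction g), hdet g⟩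
      map_one' := Subtype.ext (by
        change LinearMap.toMatrix b b (K.homologyAction 1) = 1
        rw [map_one, LinearMap.toMatrix_one])
      map_mul' := fun g h => Subtype.ext (by
        change LinearMap.toMatrix b b (K.homologyAction (g * h)) =
          LinearMap.toMatrix b b (K.homologyAction g) * LinearMap.toMatrix b b (K.homologyAction h)
        rw [map_mul, LinearMap.toMatrix_mul]) }
  have hρ : ∀ j : ℕ, (ρ (r ^ j) : Matrix (Fin (q - 1)) (Fin (q - 1)) ℤ) = companionMatrix q ^ j :=
    hpow
  refine ⟨e, b, ρ, he, fun g => rfl, fun j => ?_, ?_⟩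
  · rw [← hρ j, hr, ← map_pow, ← ofAdd_nsmul, nsmul_one]
  · have hrange : ρ.range = Subgroup.zpowers (ρ r) := by
      ext x
      constructor
      · rintro ⟨g, rfl⟩
        obtain ⟨j, rfl⟩ := hgen g
        exact ⟨j, by simp⟩
      · rintro ⟨j, rfl⟩
        exact ⟨r ^ j, by simp⟩
    have hord : orderOf (ρ r) = orderOf (companionMatrix q) := by
      rw [← hmat]
      exact (orderOf_injective Matrix.SpecialLinearGroup.coeMonoidHom
        Matrix.SpecialLinearGroup.coeMonoidHom_injective (ρ r)).symm
    rw [hrange, Nat.card_zpowers, hord, orderOf_companionMatrix hq hq3]
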